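/- A process $X=\{X(t),t\in\mathbb R\}$ is called a Brown--Resnick process with variance function $\sigma^2$ if, for every $t$, almost surely $X(t)=\max_{i\in\mathbb N} e^{U_i+W_i(t)-\sigma^2(t)/2}$, where $W_1,W_2,\dots$ are independent copies of a zero-mean, stochastically continuous Gaussian process $\{W(t),t\in\mathbb R\}$ with stationary increments, $W(0)=0$ and $\operatorname{Var}W(t)=\sigma^2(t)$, and where $\{U_i, i\in\mathbb N\}$ is, independently of the $W_i$, a Poisson point process on $\mathbb R$ with intensity $e^{-x}\,dx$. There exists a Brown--Resnick process which is (strictly) stationary and ergodic but not mixing. More precisely, the series $$\sigma^2(t)=\sum_{k=1}^{\infty}\bigl(1-\cos(2\pi t/2^{k})\bigr)$$ converges for every $t\in\mathbb R$, a Brown--Resnick process with variance function $\sigma^2$ exists, and every such process $X$ is stationary, ergodic and not mixing. Here ergodicity and mixing refer to the time shifts $(\theta_s f)(t)=f(t+s)$, $s\in\mathbb R$, on $\mathbb R^{\mathbb R}$ with the product $\sigma$-algebra and the law $\mu$ of $X$: ergodic means that every event $A$ with $\mu(\theta_s^{-1}A\,\triangle\,A)=0$ for all $s$ has $\mu(A)\in\{0,1\}$;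 mixing means that $\mu(A\cap\theta_t^{-1}B)\to\mu(A)\mu(B)$ as $t\to+\infty$ for all events $A,B$. -/

import Mathlib

open MeasureTheory ProbabilityTheory Filter Topology

noncomputable section

/-- The trajectory map of a real-valued process indexed by `ℝ`. The path space `ℝ → ℝ` carries
the product `σ`-algebra. -/
def trajectory {Ω : Type*} (X : ℝ → Ω → ℝ) (ω : Ω) : ℝ → ℝ := fun t => X t ω

/-- The law of a process on the path space. -/
def pathLaw {Ω : Type*} [MeasurableSpace Ω] (X : ℝ → Ω → ℝ) (P : Measure Ω) : Measure (ℝ → ℝ) :=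
  P.map (trajectory X)

/-- The time shift by `s`. -/
def shift (s : ℝ) (f : ℝ → ℝ) : ℝ → ℝ := fun t => f (t + s)

/-- A process is (strictly) stationary if its law is invariant under all time shifts. -/
def IsStationaryProcess {Ω : Type*} [MeasurableSpace Ω] (X : ℝ → Ω → ℝ) (P : Measure Ω) : Prop :=
  ∀ s : ℝ, (pathLaw X P).map (shift s) = pathLaw X P

/-- A process is ergodic if the shift flow is an ergodic action of `ℝ` on the path space with the
law of the process: the law is shift invariant, and every event which is, for each `s`, invariant
under the shift by `s` up to a null set has probability `0` or `1`. (Invariance has to be taken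
up to null sets: the product `σ`-algebra has no nontrivial strictly invariant sets.) -/
def IsErgodicProcess {Ω : Type*} [MeasurableSpace Ω] (X : ℝ → Ω → ℝ) (P : Measure Ω) : Prop :=
  @ErgodicVAdd ℝ (ℝ → ℝ) ⟨shift⟩ MeasurableSpace.pi (pathLaw X P)

/-- The mixing property `P[X ∈ A, X(· + t) ∈ B] → P[X ∈ A] P[X ∈ B]` as `t → ∞`, for all events
`A`, `B` of the path space. -/
def IsMixingProcess {Ω : Type*} [MeasurableSpace Ω] (X : ℝ → Ω → ℝ) (P : Measure Ω) : Prop :=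
  ∀ A B : Set (ℝ → ℝ), MeasurableSet A → MeasurableSet B →
    Tendsto (fun t : ℝ => pathLaw X P (A ∩ shift t ⁻¹' B)) atTop
      (𝓝 (pathLaw X P A * pathLaw X P B))

/-- The number of points of the sequence `U` in the set `B`, with multiplicities. -/
def pointCount {Ω E : Type*} [MeasurableSpace E] (U : ℕ → Ω → E) (B : Set E) (ω : Ω) : ENNReal :=
  (Measure.sum fun i => Measure.dirac (U i ω)) B

/-- The random points `U i`, `i ∈ ℕ`, form a Poisson point process with intensity measure `Λ`. -/
structure IsPoissonPointProcess {Ω E : Type*} [MeasurableSpace Ω] [MeasurableSpace E]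
    (U : ℕ → Ω → E) (Λ : Measure E) (P : Measure Ω) : Prop where
  measurable : ∀ i, Measurable (U i)
  law_count : ∀ B : Set E, MeasurableSet B → Λ B ≠ ⊤ →
    HasLaw (pointCount U B)
      ((poissonMeasure (Λ B).toNNReal).map (fun n : ℕ => (n : ENNReal))) P
  indep_count : ∀ (n : ℕ) (B : Fin n → Set E), (∀ j, MeasurableSet (B j)) → (∀ j, Λ (B j) ≠ ⊤) →
    Pairwise (fun i j => Disjoint (B i) (B j)) → iIndepFun (fun j => pointCount U (B j)) P

/-- `W` is a zero-mean stochastically continuous Gaussian process on `ℝ` with stationary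
increments, `W 0 = 0` and variance function `v`. -/
structure IsStatIncrGaussian {Ω : Type*} [MeasurableSpace Ω] (W : ℝ → Ω → ℝ) (v : ℝ → ℝ)
    (P : Measure Ω) : Prop where
  measurable : ∀ t, Measurable (W t)
  gaussian : IsGaussianProcess W P
  mean_zero : ∀ t, ∫ ω, W t ω ∂P = 0
  start_zero : ∀ᵐ ω ∂P, W 0 ω = 0
  variance_eq : ∀ t, variance (W t) P = v t
  stationary_increments : ∀ s : ℝ,
    IdentDistrib (trajectory fun t ω => W (t + s) ω - W s ω)
      (trajectory fun t ω => W t ω - W 0 ω) P P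
  stochastically_continuous : ∀ t : ℝ, TendstoInMeasure P W (𝓝 t) (W t)

/-- `X` is the Brown–Resnick process built from the points `U i` of a Poisson point process on `ℝ`
with intensity `e ^ (-x) dx` and, independently of them, from independent copies `W i` of a
Gaussian process with variance function `v`:
`X t = max_i exp (U i + W i t - v t / 2)` almost surely, for every `t`. -/
structure IsBrownResnickOf {Ω : Type*} [MeasurableSpace Ω] (X : ℝ → Ω → ℝ) (U : ℕ → Ω → ℝ)
    (W : ℕ → ℝ → Ω → ℝ) (v : ℝ → ℝ) (P : Measure Ω) : Prop where
  poisson : IsPoissonPointProcess U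
    (volume.withDensity fun x : ℝ => ENNReal.ofReal (Real.exp (-x))) P
  gaussian : ∀ i, IsStatIncrGaussian (W i) v P
  copies : ∀ i j, IdentDistrib (trajectory (W i)) (trajectory (W j)) P P
  independent : iIndepFun (fun i => trajectory (W i)) P
  independent_points : IndepFun (fun ω i => U i ω) (fun ω i => trajectory (W i) ω) P
  measurable : ∀ t, Measurable (X t)
  eq_max : ∀ t, ∀ᵐ ω ∂P,
    IsGreatest (Set.range fun i => Real.exp (U i ω + W i t ω - v t / 2)) (X t ω)

/-- `X` is a Brown–Resnick process with variance function `v`. -/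
def IsBrownResnick {Ω : Type*} [MeasurableSpace Ω] (X : ℝ → Ω → ℝ) (v : ℝ → ℝ)
    (P : Measure Ω) : Prop :=
  ∃ (U : ℕ → Ω → ℝ) (W : ℕ → ℝ → Ω → ℝ), IsBrownResnickOf X U W v P

/-- The `k`-th term (`k ≥ 1`, here shifted to `k ≥ 0`) of the variance function of the example. -/
def dyadicTerm (t : ℝ) (k : ℕ) : ℝ := 1 - Real.cos (2 * Real.pi * t / 2 ^ (k + 1))

/-- The variance function `∑_{k ≥ 1} (1 - cos (2 π t / 2 ^ k))`. -/
def dyadicVariance (t : ℝ) : ℝ := ∑' k : ℕ, dyadicTerm t k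

end

/-! Let V(L) be the expectation of the maximum over a ∈ L of exp(W(a.1) - σ²(a.1)/2) / a.2.
Attaching the independent marks W_i to the Poisson points U_i and computing a Laplace functional
gives P(X(a.1) ≤ a.2 for all a ∈ L) = exp(-V(L)) (`IsBrownResnickOf.pathLaw_lowerCylinder`). These
lower cylinders form a generating π-system, so stationarity and mixing become statements about V.

Stationarity: tilting the Gaussian law by exp(W(s) - σ²(s)/2) adds the covariance with W(s) as a
drift. Together with stationary increments this makes expectations of homogeneous functionals of W -
σ²/2 shift invariant (`IsStatIncrGaussian.lintegral_homogeneous_shift`), and hence V as well.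

Dependence: by max + min = sum, V(L) + V(L') - V(L ∪ (L' + s)) is the expectation of a minimum,
bounded by a finite sum of multiples of exp(-σ²(s + c)/8). So X mixes along every sequence τ with
σ²(τ_n + c) → ∞ for all c (`IsBrownResnickOf.tendsto_measureReal_inter`). Mixing along one sequence
already forces ergodicity, since an invariant event then satisfies μ(A) = μ(A)². In contrast, if σ²
is constant along a sequence tending to infinity, the joint law of X(0) and X(τ_n) retains a fixed
dependence and mixing fails (`IsBrownResnickOf.not_isMixing`).

The dyadic σ² has both kinds of sequences because σ²(2t) = σ²(t) + 1 - cos(2πt)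
(`dyadicVariance_two_mul`). Starting from t = 1, doubling adds 0 at every step; starting from t =
1/3 it adds 3/2 at every step.

Existence: W is a random Fourier series with absolutely summable coefficients
(`isStatIncrGaussian_dyadic`). The Poisson process is a superposition of independent batches, each a
Poisson(1) number of i.i.d. points, one batch for each unit-mass piece of the intensity
(`isPoissonPointProcess_clusterPoint`). The maximum is attained by Borel–Cantelli, since the
expected number of marked points above any level is finite
(`IsPoissonPointProcess.ae_isGreatest_exp`). -/

noncomputable section

/-! ### Laplace functional of a Poisson point process. -/

/-- The function `x ↦ e ^ (-x)` on the extended nonnegative reals. -/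
def expNeg (x : ENNReal) : ENNReal := EReal.exp (-(x : EReal))

@[simp] lemma expNeg_zero : expNeg 0 = 1 := by simp [expNeg]

@[simp] lemma expNeg_top : expNeg ⊤ = 0 := by simp [expNeg]

lemma continuous_expNeg : Continuous expNeg :=
  ENNReal.continuous_exp.comp (continuous_neg.comp continuous_coe_ennreal_ereal)

lemma measurable_expNeg : Measurable expNeg := continuous_expNeg.measurable

lemma expNeg_antitone : Antitone expNeg := fun x y h => by
  simp only [expNeg, EReal.exp_le_exp_iff]
  exact EReal.neg_le_neg_iff.2 (by exact_mod_cast h)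

lemma expNeg_le_one (x : ENNReal) : expNeg x ≤ 1 := by
  simpa using expNeg_antitone (zero_le (a := x))

lemma expNeg_ne_top (x : ENNReal) : expNeg x ≠ ⊤ :=
  ((expNeg_le_one x).trans_lt ENNReal.one_lt_top).ne

lemma expNeg_add (x y : ENNReal) : expNeg (x + y) = expNeg x * expNeg y := by
  simp only [expNeg, EReal.coe_ennreal_add]
  rw [EReal.neg_add (by simp) (by simp), sub_eq_add_neg, EReal.exp_add]

lemma expNeg_sum {ι : Type*} (s : Finset ι) (f : ι → ENNReal) :
    expNeg (∑ i ∈ s, f i) = ∏ i ∈ s, expNeg (f i) := by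
  classical
  induction s using Finset.induction with
  | empty => simp
  | insert a s ha ih => rw [Finset.sum_insert ha, Finset.prod_insert ha, expNeg_add, ih]

lemma expNeg_ofReal {r : ℝ} (hr : 0 ≤ r) :
    expNeg (ENNReal.ofReal r) = ENNReal.ofReal (Real.exp (-r)) := by
  rw [expNeg, EReal.coe_ennreal_ofReal, max_eq_left hr, ← EReal.coe_neg, EReal.exp_coe]

lemma expNeg_mul_natCast (c : ENNReal) (n : ℕ) : expNeg (c * n) = expNeg c ^ n := by
  induction n with
  | zero => simp
  | succ n ih => rw [Nat.cast_succ, mul_add, expNeg_add, ih, mul_one, pow_succ]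

lemma expNeg_injective : Function.Injective expNeg := fun x y h => by
  have := EReal.exp_strictMono.injective h
  simpa using this

lemma tendsto_expNeg_tsum (f : ℕ → ENNReal) :
    Tendsto (fun n => ∏ i ∈ Finset.range n, expNeg (f i)) atTop (𝓝 (expNeg (∑' i, f i))) := by
  simp_rw [← expNeg_sum]
  exact (continuous_expNeg.tendsto _).comp (ENNReal.tendsto_nat_tsum f)

/-- The function `x ↦ -log x`, an inverse of `expNeg` on `[0, 1]`. -/
def negLog (p : ENNReal) : ENNReal := (-(ENNReal.log p)).toENNReal

lemma measurable_negLog : Measurable negLog := by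
  unfold negLog; fun_prop

lemma expNeg_negLog {p : ENNReal} (hp : p ≤ 1) : expNeg (negLog p) = p := by
  rw [expNeg, negLog, EReal.coe_toENNReal, neg_neg, ENNReal.exp_log]
  rw [EReal.le_neg, neg_zero]
  simpa using hp

lemma pointCount_eq_tsum {Ω E : Type*} [MeasurableSpace E] (U : ℕ → Ω → E)
    {B : Set E} (hB : MeasurableSet B) (ω : Ω) :
    pointCount U B ω = ∑' i, B.indicator 1 (U i ω) := by
  rw [pointCount, Measure.sum_apply _ hB]
  exact tsum_congr fun i => Measure.dirac_apply' _ hB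

variable {Ω E : Type*} [MeasurableSpace Ω] [MeasurableSpace E]

lemma lintegral_sum_dirac (u : ℕ → E) {f : E → ENNReal} (hf : Measurable f) :
    ∫⁻ x, f x ∂(Measure.sum fun i => Measure.dirac (u i)) = ∑' i, f (u i) := by
  rw [lintegral_sum_measure]
  exact tsum_congr fun i => lintegral_dirac' _ hf

lemma measurable_pointCount {U : ℕ → Ω → E} (hU : ∀ i, Measurable (U i)) {B : Set E}
    (hB : MeasurableSet B) : Measurable (pointCount U B) := by
  have : pointCount U B = fun ω => ∑' i, B.indicator 1 (U i ω) :=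
    funext fun ω => pointCount_eq_tsum U hB ω
  rw [this]
  exact Measurable.tsum fun i => (measurable_one.indicator hB).comp (hU i)

/-- With q = e^{-c}, this is the generating function E q^N = e^{-(1-q)r}. The value c = ⊤ is
allowed: then q = 0, and ⊤ * 0 = 0 matches 0 ^ 0 = 1. -/
lemma lintegral_expNeg_poissonMeasure (r : NNReal) (c : ENNReal) :
    ∫⁻ n : ℕ, expNeg (c * n) ∂(poissonMeasure r) = expNeg ((1 - expNeg c) * r) := by
  set q := expNeg c with hq
  have hq1 : q ≤ 1 := expNeg_le_one c
  lift q to NNReal using expNeg_ne_top c with q'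
  have hq1' : (q' : ℝ) ≤ 1 := by exact_mod_cast hq1
  have h1 : (1 - (q' : ENNReal)) * r = ENNReal.ofReal ((1 - q') * r) := by
    rw [ENNReal.ofReal_mul (by linarith), ENNReal.ofReal_sub _ (by positivity)]
    simp
  rw [h1, expNeg_ofReal (by have := r.2; nlinarith [NNReal.coe_nonneg r]), poissonMeasure,
    lintegral_sum_measure]
  have h2 : ∀ n : ℕ, ∫⁻ m : ℕ, expNeg (c * m)
      ∂(ENNReal.ofReal (Real.exp (-r) * r ^ n / n.factorial) • Measure.dirac n)
      = ENNReal.ofReal (Real.exp (-r) * ((q' * r : ℝ) ^ n / n.factorial)) := fun n => by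
    rw [lintegral_smul_measure, lintegral_dirac, expNeg_mul_natCast, ← hq, smul_eq_mul,
      ← ENNReal.ofReal_coe_nnreal, ← ENNReal.ofReal_pow (by positivity),
      ← ENNReal.ofReal_mul (by positivity)]
    congr 1
    ring
  have h3 := (NormedSpace.expSeries_div_hasSum_exp (q' * r : ℝ)).mul_left (Real.exp (-r))
  rw [← Real.exp_eq_exp_ℝ] at h3
  simp_rw [h2]
  rw [← ENNReal.ofReal_tsum_of_nonneg (fun n => by positivity) h3.summable, h3.tsum_eq,
    ← Real.exp_add]
  congr 2; ring

section Laplace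

variable {P : Measure Ω} {U : ℕ → Ω → E} {Λ : Measure E}

/-- The sum over the points is a combination of the counts in the disjoint level sets, which are
independent Poisson variables, so the expectation factorises. -/
lemma IsPoissonPointProcess.lintegral_expNeg_simpleFunc (h : IsPoissonPointProcess U Λ P)
    (f : SimpleFunc E ENNReal) (hf : ∀ c ≠ 0, Λ (f ⁻¹' {c}) ≠ ⊤) :
    ∫⁻ ω, expNeg (∑' i, f (U i ω)) ∂P = expNeg (∫⁻ x, (1 - expNeg (f x)) ∂Λ) := by
  classical
  -- The value 0 is dropped: its level set may have infinite intensity, and it contributes nothing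
  -- to either side.
  let s := f.range.filter (· ≠ 0)
  have hs : ∀ c : s, Λ (f ⁻¹' {(c : ENNReal)}) ≠ ⊤ := fun c => hf _ (Finset.mem_filter.1 c.2).2
  have hB : ∀ c : ENNReal, MeasurableSet (f ⁻¹' {c}) := fun c => f.measurableSet_preimage _
  have hind : iIndepFun (fun c : s => pointCount U (f ⁻¹' {(c : ENNReal)})) P := by
    have h1 := h.indep_count s.card (fun j => f ⁻¹' {((s.equivFin.symm j : s) : ENNReal)})
      (fun j => hB _) (fun j => hs _) (fun i j hij => by
        refine Disjoint.preimage _ (Set.disjoint_singleton.2 fun h => hij ?_)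
        exact s.equivFin.symm.injective (Subtype.ext h))
    simpa using h1.precomp s.equivFin.injective
  have h1 : ∀ ω, ∑' i, f (U i ω) = ∑ c : s, (c : ENNReal)
      * pointCount U (f ⁻¹' {(c : ENNReal)}) ω := by
    intro ω
    rw [← lintegral_sum_dirac (fun i => U i ω) f.measurable, SimpleFunc.lintegral_eq_lintegral,
      SimpleFunc.lintegral, Finset.sum_coe_sort s
        (fun c => c * pointCount U (f ⁻¹' {(c : ENNReal)}) ω), Finset.sum_filter]
    refine Finset.sum_congr rfl fun c _ => ?_
    by_cases hc : c = 0 <;> simp [hc, pointCount]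
  have h2 : ∫⁻ x, (1 - expNeg (f x)) ∂Λ = ∑ c : s, (1 - expNeg c) * Λ (f ⁻¹' {(c : ENNReal)}) := by
    have := SimpleFunc.lintegral_eq_lintegral (f.map fun c => 1 - expNeg c) Λ
    simp only [SimpleFunc.coe_map, Function.comp_apply] at this
    rw [this, SimpleFunc.map_lintegral, Finset.sum_coe_sort s
        (fun c => (1 - expNeg c) * Λ (f ⁻¹' {(c : ENNReal)})), Finset.sum_filter]
    refine Finset.sum_congr rfl fun c _ => ?_
    by_cases hc : c = 0 <;> simp [hc]
  simp_rw [h1, h2, expNeg_sum]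
  have hmc : ∀ c : s, Measurable (fun x => expNeg ((c : ENNReal) * x)) := fun c =>
    measurable_expNeg.comp (measurable_const.mul measurable_id)
  have hmp := fun c : s => measurable_pointCount h.measurable (hB c)
  have := lintegral_prod_eq_prod_lintegral_of_indepFun Finset.univ
    (fun (c : s) ω => expNeg ((c : ENNReal) * pointCount U (f ⁻¹' {(c : ENNReal)}) ω))
    (hind.comp _ hmc) (fun c => (hmc c).comp (hmp c))
  rw [this]
  refine Finset.prod_congr rfl fun c _ => ?_
  have hlaw := h.law_count (f ⁻¹' {(c : ENNReal)}) (hB c) (hs c)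
  rw [← lintegral_map (hmc c) (hmp c), hlaw.map_eq, lintegral_map (hmc c) (by fun_prop),
    lintegral_expNeg_poissonMeasure, ENNReal.coe_toNNReal (hs c)]

/-- Infinite values of f must be admitted, because f will be `-log` of a probability that may
vanish. -/
lemma IsPoissonPointProcess.lintegral_expNeg [SigmaFinite Λ] [IsProbabilityMeasure P]
    (h : IsPoissonPointProcess U Λ P) {f : E → ENNReal} (hf : Measurable f) :
    ∫⁻ ω, expNeg (∑' i, f (U i ω)) ∂P = expNeg (∫⁻ x, (1 - expNeg (f x)) ∂Λ) := by
  let S := spanningSets Λ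
  have hS : ∀ n, MeasurableSet (S n) := measurableSet_spanningSets Λ
  -- Restricting to the spanning sets makes all nonzero level sets of finite intensity, and keeps
  -- monotone convergence to f.
  let g : ℕ → SimpleFunc E ENNReal := fun n => (SimpleFunc.eapprox f n).restrict (S n)
  have hg : ∀ n x, g n x = (S n).indicator (SimpleFunc.eapprox f n) x := fun n x =>
    SimpleFunc.restrict_apply _ (hS n) x
  have hmono : ∀ x, Monotone fun n => g n x := fun x m n hmn => by
    simp only [hg]
    exact (Set.indicator_le_indicator (SimpleFunc.monotone_eapprox f hmn x)).trans
      (Set.indicator_le_indicator_of_subset (monotone_spanningSets Λ hmn) (fun _ => zero_le) x)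
  have hlim : ∀ x, Tendsto (fun n => g n x) atTop (𝓝 (f x)) := fun x => by
    refine (SimpleFunc.tendsto_eapprox hf x).congr' ?_
    filter_upwards [eventually_mem_spanningSets Λ x] with n hn
    rw [hg, Set.indicator_of_mem hn]
  have hfin : ∀ n, ∀ c ≠ 0, Λ (g n ⁻¹' {c}) ≠ ⊤ := fun n c hc => by
    rw [SimpleFunc.restrict_preimage_singleton _ (hS n) hc]
    exact ((measure_mono Set.inter_subset_left).trans_lt (measure_spanningSets_lt_top Λ n)).ne
  have hsum : ∀ ω, Tendsto (fun n => ∑' i, g n (U i ω)) atTop (𝓝 (∑' i, f (U i ω))) := fun ω => by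
    have := lintegral_tendsto_of_tendsto_of_monotone
      (μ := Measure.sum fun i => Measure.dirac (U i ω)) (f := fun n x => g n x) (F := f)
      (fun n => (g n).measurable.aemeasurable) (ae_of_all _ hmono) (ae_of_all _ hlim)
    rw [lintegral_sum_dirac _ hf] at this
    exact this.congr fun n => lintegral_sum_dirac _ (g n).measurable
  have hL : Tendsto (fun n => ∫⁻ ω, expNeg (∑' i, g n (U i ω)) ∂P) atTop
      (𝓝 (∫⁻ ω, expNeg (∑' i, f (U i ω)) ∂P)) := by
    refine tendsto_lintegral_of_dominated_convergence (fun _ => 1) (fun n => ?_)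
      (fun n => ae_of_all _ fun ω => expNeg_le_one _) (by simp)
      (ae_of_all _ fun ω => (continuous_expNeg.tendsto _).comp (hsum ω))
    exact measurable_expNeg.comp
      (Measurable.tsum fun i => (g n).measurable.comp (h.measurable i))
  have hR : Tendsto (fun n => ∫⁻ x, (1 - expNeg (g n x)) ∂Λ) atTop
      (𝓝 (∫⁻ x, (1 - expNeg (f x)) ∂Λ)) := by
    refine lintegral_tendsto_of_tendsto_of_monotone (fun n => ?_) (ae_of_all _ fun x m n hmn => ?_)
      (ae_of_all _ fun x => ?_)
    · exact (measurable_const.sub (measurable_expNeg.comp (g n).measurable)).aemeasurable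
    · exact tsub_le_tsub_left (expNeg_antitone (hmono x hmn)) _
    · exact ENNReal.Tendsto.sub tendsto_const_nhds
        ((continuous_expNeg.tendsto _).comp (hlim x)) (by simp)
  refine tendsto_nhds_unique hL ?_
  refine ((continuous_expNeg.tendsto _).comp hR).congr fun n => ?_
  exact (h.lintegral_expNeg_simpleFunc (g n) (hfin n)).symm

end Laplace

/-! ### The exponential intensity and the maximum of independently marked points. -/

/-- The intensity measure `e ^ (-x) dx`. -/
abbrev expIntensity : Measure ℝ := volume.withDensity fun x : ℝ => ENNReal.ofReal (Real.exp (-x))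

instance : SigmaFinite expIntensity :=
  SigmaFinite.withDensity_ofReal _

/-- In the coordinate y = e^{-u} the intensity is Lebesgue measure on (0, ∞), and the set is the
interval (0, m). -/
lemma expIntensity_setOf_exp_neg_lt (m : ENNReal) :
    expIntensity {u | ENNReal.ofReal (Real.exp (-u)) < m} = m := by
  have key : ∀ r : NNReal, expIntensity {u | ENNReal.ofReal (Real.exp (-u)) < r} = r := by
    intro r
    rcases eq_or_ne r 0 with rfl | hr
    · simp
    have hr0 : (0 : ℝ) < r := by positivity
    have hset : {u : ℝ | ENNReal.ofReal (Real.exp (-u)) < r} = Set.Ioi (-Real.log r) := by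
      ext u
      rw [Set.mem_ofPred_eq, ← ENNReal.ofReal_coe_nnreal, ENNReal.ofReal_lt_ofReal_iff hr0,
        Set.mem_Ioi, ← Real.lt_log_iff_exp_lt hr0]
      constructor <;> intro h <;> linarith
    rw [hset, withDensity_apply _ measurableSet_Ioi,
      ← ofReal_integral_eq_lintegral_ofReal (integrableOn_exp_neg_Ioi _)
        (ae_of_all _ fun x => (Real.exp_pos _).le), integral_exp_neg_Ioi, neg_neg,
      Real.exp_log hr0, ENNReal.ofReal_coe_nnreal]
  induction m with
  | top =>
    refine top_unique (ENNReal.le_of_forall_nnreal_lt fun r _ => ?_)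
    rw [← key r]
    exact measure_mono fun u hu => Set.mem_ofPred.2 ENNReal.ofReal_lt_top
  | coe r => exact key r

variable {Ω : Type*} [MeasurableSpace Ω] {P : Measure Ω} [IsProbabilityMeasure P]

/-- By independence the probability is an infinite product, written as the exponential of a sum of
logarithms. A vanishing factor is covered by `negLog 0 = ⊤`. -/
lemma measure_forall_mul_le_one {M : ℕ → Ω → ENNReal} (hM : ∀ i, Measurable (M i))
    (hident : ∀ i, P.map (M i) = P.map (M 0)) (hind : iIndepFun M P) (c : ℕ → ENNReal) :
    P {ω | ∀ i, c i * M i ω ≤ 1} = expNeg (∑' i, negLog (P {ω | c i * M 0 ω ≤ 1})) := by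
  have hset : ∀ a : ENNReal, MeasurableSet {m : ENNReal | a * m ≤ 1} := fun a =>
    measurableSet_le (measurable_const.mul measurable_id) measurable_const
  let A : ℕ → Set Ω := fun n => ⋂ i ∈ Finset.range n, M i ⁻¹' {m | c i * m ≤ 1}
  have hA : ∀ n, P (A n) = ∏ i ∈ Finset.range n, expNeg (negLog (P {ω | c i * M 0 ω ≤ 1})) := by
    intro n
    rw [hind.measure_inter_preimage_eq_mul _ (fun i _ => hset (c i))]
    refine Finset.prod_congr rfl fun i _ => ?_
    rw [expNeg_negLog prob_le_one, ← Measure.map_apply (hM i) (hset _), hident i,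
      Measure.map_apply (hM 0) (hset _)]
    rfl
  have hlim : Tendsto (fun n => P (A n)) atTop (𝓝 (P (⋂ n, A n))) := by
    refine tendsto_measure_iInter_atTop (fun n => ?_) (fun m n hmn => ?_) ⟨0, measure_ne_top _ _⟩
    · exact (MeasurableSet.biInter (Finset.range n).countable_toSet
        fun i _ => hM i (hset _)).nullMeasurableSet
    · exact Set.biInter_subset_biInter_left fun i hi => by
        simp only [Finset.coe_range, Set.mem_Iio] at hi ⊢; omega
  have hAe : {ω | ∀ i, c i * M i ω ≤ 1} = ⋂ n, A n := by
    ext ω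
    simp only [Set.mem_ofPred_eq, A, Set.mem_iInter, Finset.mem_range, Set.mem_preimage]
    exact ⟨fun h _ i _ => h i, fun h i => h (i + 1) i (Nat.lt_succ_self i)⟩
  rw [hAe]
  exact tendsto_nhds_unique hlim ((tendsto_expNeg_tsum _).congr fun n => (hA n).symm)

/-- Tonelli: the left side is the expected intensity of {u : e^{-u} < M}, and that set has mass M.
-/
lemma lintegral_one_sub_measure_exp_mul_le {M : Ω → ENNReal} (hM : Measurable M) :
    ∫⁻ u, (1 - P {ω | ENNReal.ofReal (Real.exp u) * M ω ≤ 1}) ∂expIntensity = ∫⁻ ω, M ω ∂P := by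
  have h1 : ∀ u : ℝ, 1 - P {ω | ENNReal.ofReal (Real.exp u) * M ω ≤ 1}
      = P {ω | ENNReal.ofReal (Real.exp (-u)) < M ω} := by
    intro u
    rw [← prob_compl_eq_one_sub (s := {ω | ENNReal.ofReal (Real.exp u) * M ω ≤ 1})
      (measurableSet_le (by fun_prop) measurable_const)]
    congr 1
    ext ω
    simp only [Set.mem_compl_iff, Set.mem_ofPred_eq, not_le]
    rw [Real.exp_neg, ENNReal.ofReal_inv_of_pos (Real.exp_pos u), mul_comm,
      ← ENNReal.div_lt_iff (Or.inl (by simp [Real.exp_pos])) (Or.inl ENNReal.ofReal_ne_top),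
      one_div]
  simp_rw [h1]
  have hS : MeasurableSet {z : ℝ × Ω | ENNReal.ofReal (Real.exp (-z.1)) < M z.2} :=
    measurableSet_lt (by fun_prop) (by fun_prop)
  have h2 := Measure.prod_apply (μ := expIntensity) (ν := P) hS
  have h3 := Measure.prod_apply_symm (μ := expIntensity) (ν := P) hS
  rw [h2] at h3
  simp only [Set.preimage_ofPred_eq] at h3
  rw [h3]
  exact lintegral_congr fun ω => expIntensity_setOf_exp_neg_lt _

/-- The maximum of `e ^ (U i) * M i`, for independent marks `M i`, has a Fréchet-type law. -/
theorem IsPoissonPointProcess.measure_forall_exp_mul_le_one {U : ℕ → Ω → ℝ}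
    (h : IsPoissonPointProcess U expIntensity P) {M : ℕ → Ω → ENNReal}
    (hM : ∀ i, Measurable (M i)) (hident : ∀ i, P.map (M i) = P.map (M 0)) (hind : iIndepFun M P)
    (hUM : IndepFun (fun ω i => U i ω) (fun ω i => M i ω) P) :
    P {ω | ∀ i, ENNReal.ofReal (Real.exp (U i ω)) * M i ω ≤ 1} = expNeg (∫⁻ ω, M 0 ω ∂P) := by
  have hmU : Measurable fun ω i => U i ω := measurable_pi_lambda _ h.measurable
  have hmM : Measurable fun ω i => M i ω := measurable_pi_lambda _ hM
  let S : Set ((ℕ → ℝ) × (ℕ → ENNReal)) := {z | ∀ i, ENNReal.ofReal (Real.exp (z.1 i)) * z.2 i ≤ 1}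
  have hS : MeasurableSet S := by
    simp only [S, Set.ofPred_forall]
    exact MeasurableSet.iInter fun i => measurableSet_le (by fun_prop) measurable_const
  let p : ℝ → ENNReal := fun u => P {ω | ENNReal.ofReal (Real.exp u) * M 0 ω ≤ 1}
  have hp : Measurable p := by
    have hT : MeasurableSet {z : ℝ × Ω | ENNReal.ofReal (Real.exp z.1) * M 0 z.2 ≤ 1} :=
      measurableSet_le (by have := hM 0; fun_prop) measurable_const
    exact measurable_measure_prodMk_left hT
  have h1 : P {ω | ∀ i, ENNReal.ofReal (Real.exp (U i ω)) * M i ω ≤ 1}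
      = P.map (fun ω => (fun i => U i ω, fun i => M i ω)) S := by
    rw [Measure.map_apply (hmU.prodMk hmM) hS]; rfl
  rw [h1, (indepFun_iff_map_prod_eq_prod_map_map hmU.aemeasurable hmM.aemeasurable).1 hUM,
    Measure.prod_apply hS, lintegral_map (measurable_measure_prodMk_left hS) hmU]
  -- With the points frozen, the marks give a product of probabilities p(U i). What remains is the
  -- Laplace functional of -log p, whose exponent is the integral of 1 - p.
  have h2 : ∀ ω, (P.map fun ω i => M i ω) (Prod.mk (fun i => U i ω) ⁻¹' S)
      = expNeg (∑' i, negLog (p (U i ω))) := fun ω => by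
    rw [Measure.map_apply hmM (measurable_prodMk_left hS)]
    exact measure_forall_mul_le_one hM hident hind fun i => ENNReal.ofReal (Real.exp (U i ω))
  simp_rw [h2]
  rw [h.lintegral_expNeg (f := fun u => negLog (p u)) (measurable_negLog.comp hp)]
  congr 1
  rw [← lintegral_one_sub_measure_exp_mul_le (hM 0)]
  exact lintegral_congr fun u => by rw [expNeg_negLog prob_le_one]

/-! ### Exponential tilting of centred real Gaussians. -/

section Real

/-- Completing the square turns the tilt into a translation of the mean by v. The degenerate case
has no density and is treated as a Dirac mass. -/
lemma withDensity_exp_gaussianReal (v : NNReal) :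
    (gaussianReal 0 v).withDensity (fun z => ENNReal.ofReal (Real.exp (z - v / 2)))
      = gaussianReal v v := by
  rcases eq_or_ne v 0 with rfl | hv
  · simp [dirac_withDensity]
  · rw [gaussianReal_of_var_ne_zero _ hv, gaussianReal_of_var_ne_zero _ hv,
      ← withDensity_mul _ (measurable_gaussianPDF _ _) (by fun_prop)]
    congr 1
    ext z
    rw [Pi.mul_apply, gaussianPDF, gaussianPDF, ← ENNReal.ofReal_mul (gaussianPDFReal_nonneg _ _ _)]
    congr 1
    rw [gaussianPDFReal, gaussianPDFReal, mul_assoc, ← Real.exp_add]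
    congr 2
    have : (v : ℝ) ≠ 0 := by exact_mod_cast hv
    field_simp
    ring

lemma lintegral_exp_mul_gaussianReal (v : NNReal) {g : ℝ → ENNReal} (hg : Measurable g) :
    ∫⁻ z, ENNReal.ofReal (Real.exp (z - v / 2)) * g z ∂(gaussianReal 0 v)
      = ∫⁻ z, g (z + v) ∂(gaussianReal 0 v) := by
  have h1 := lintegral_withDensity_eq_lintegral_mul (gaussianReal 0 v)
    (f := fun z : ℝ => ENNReal.ofReal (Real.exp (z - v / 2))) (by fun_prop) hg
  simp only [Pi.mul_apply] at h1
  rw [← h1, withDensity_exp_gaussianReal, ← lintegral_map hg (by fun_prop : Measurable (· + (v:ℝ))),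
    gaussianReal_map_add_const, zero_add]

variable {Ω : Type*} [MeasurableSpace Ω] {P : Measure Ω}

lemma ProbabilityTheory.HasGaussianLaw.map_eq_of_integral_eq_zero {Z : Ω → ℝ}
    (hZ : HasGaussianLaw Z P) (h0 : ∫ ω, Z ω ∂P = 0) :
    P.map Z = gaussianReal 0 (variance Z P).toNNReal := by
  rw [hZ.map_eq_gaussianReal, h0]

lemma ProbabilityTheory.HasGaussianLaw.lintegral_exp_sub {Z : Ω → ℝ}
    (hZ : HasGaussianLaw Z P) (h0 : ∫ ω, Z ω ∂P = 0) (b : ℝ) :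
    ∫⁻ ω, ENNReal.ofReal (Real.exp (Z ω - b)) ∂P
      = ENNReal.ofReal (Real.exp (variance Z P / 2 - b)) := by
  have h1 := lintegral_exp_mul_gaussianReal (variance Z P).toNNReal (g := fun _ => 1)
    measurable_const
  rw [← hZ.map_eq_of_integral_eq_zero h0,
    lintegral_map' (by fun_prop) hZ.aemeasurable, lintegral_map' (by fun_prop) hZ.aemeasurable,
    Real.coe_toNNReal _ (variance_nonneg _ _)] at h1
  have := hZ.isProbabilityMeasure
  simp only [mul_one, lintegral_one, measure_univ] at h1
  have h2 : ∀ ω, ENNReal.ofReal (Real.exp (Z ω - b))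
      = ENNReal.ofReal (Real.exp (Z ω - variance Z P / 2))
        * ENNReal.ofReal (Real.exp (variance Z P / 2 - b)) := fun ω => by
    rw [← ENNReal.ofReal_mul (Real.exp_pos _).le, ← Real.exp_add]
    congr 2; ring
  simp_rw [h2]
  rw [lintegral_mul_const' _ _ ENNReal.ofReal_ne_top, h1, one_mul]

end Real

/-! ### Gaussian processes with stationary increments and their change of measure. -/

namespace IsStatIncrGaussian

variable {Ω : Type*} [MeasurableSpace Ω] {P : Measure Ω}
  {W : ℝ → Ω → ℝ} {v : ℝ → ℝ}

lemma measurable_trajectory (h : IsStatIncrGaussian W v P) : Measurable (trajectory W) :=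
  measurable_pi_lambda _ h.measurable

lemma memLp_two (h : IsStatIncrGaussian W v P) (t : ℝ) : MemLp (W t) 2 P :=
  (h.gaussian.hasGaussianLaw_eval t).memLp_two

lemma nonneg (h : IsStatIncrGaussian W v P) (t : ℝ) : 0 ≤ v t := by
  rw [← h.variance_eq]; exact variance_nonneg _ _

lemma variance_sub (h : IsStatIncrGaussian W v P) (s t : ℝ) :
    variance (fun ω => W t ω - W s ω) P = v (t - s) := by
  have h1 := ((h.stationary_increments s).comp (u := fun f => f (t - s)) (by fun_prop)).variance_eq
  have h2 : variance (fun ω => W (t - s) ω - W 0 ω) P = variance (W (t - s)) P := by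
    refine variance_congr ?_
    filter_upwards [h.start_zero] with ω hω
    rw [hω, sub_zero]
  simpa [Function.comp_def, trajectory, h2, h.variance_eq] using h1

lemma covariance_eq (h : IsStatIncrGaussian W v P) (s t : ℝ) :
    covariance (W t) (W s) P = (v t + v s - v (t - s)) / 2 := by
  have := h.gaussian.isProbabilityMeasure
  have := variance_fun_sub (h.memLp_two t) (h.memLp_two s)
  rw [h.variance_sub, h.variance_eq, h.variance_eq] at this
  linarith

lemma lintegral_exp (h : IsStatIncrGaussian W v P) (t : ℝ) :
    ∫⁻ ω, ENNReal.ofReal (Real.exp (W t ω - v t / 2)) ∂P = 1 := by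
  rw [(h.gaussian.hasGaussianLaw_eval t).lintegral_exp_sub (h.mean_zero t), h.variance_eq]
  simp

/-- A minimum is at most the geometric mean, whose exponent is Gaussian. Half the variance (2 v(t) +
2 v(s) - v(t - s))/4, less (v(t) + v(s))/4, equals -v(t - s)/8. -/
lemma lintegral_min_exp_le (h : IsStatIncrGaussian W v P) (s t : ℝ) :
    ∫⁻ ω, min (ENNReal.ofReal (Real.exp (W t ω - v t / 2)))
      (ENNReal.ofReal (Real.exp (W s ω - v s / 2))) ∂P
      ≤ ENNReal.ofReal (Real.exp (-(v (t - s) / 8))) := by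
  have := h.gaussian.isProbabilityMeasure
  have hG : HasGaussianLaw (fun ω => (1 / 2 : ℝ) • (W t ω + W s ω)) P :=
    (h.gaussian.hasGaussianLaw_fun_add (s := t) (t := s)).fun_smul (1 / 2 : ℝ)
  have hi : ∀ u, Integrable (W u) P := fun u => (h.memLp_two u).integrable one_le_two
  have h0 : ∫ ω, (1 / 2 : ℝ) • (W t ω + W s ω) ∂P = 0 := by
    rw [integral_smul, integral_add (hi t) (hi s), h.mean_zero, h.mean_zero]; simp
  have hv : variance (fun ω => (1 / 2 : ℝ) • (W t ω + W s ω)) P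
      = (2 * v t + 2 * v s - v (t - s)) / 4 := by
    simp only [smul_eq_mul]
    rw [variance_const_mul, variance_fun_add (h.memLp_two t) (h.memLp_two s), h.covariance_eq,
      h.variance_eq, h.variance_eq]
    ring
  have key := hG.lintegral_exp_sub h0 ((v t + v s) / 4)
  rw [hv] at key
  calc _ ≤ ∫⁻ ω, ENNReal.ofReal (Real.exp ((1 / 2 : ℝ) • (W t ω + W s ω) - (v t + v s) / 4)) ∂P := by
        refine lintegral_mono fun ω => ?_
        simp only [smul_eq_mul]
        rcases le_total (W t ω - v t / 2) (W s ω - v s / 2) with hle | hle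
        · exact (min_le_left _ _).trans (ENNReal.ofReal_le_ofReal (Real.exp_le_exp.2 (by linarith)))
        · exact (min_le_right _ _).trans
            (ENNReal.ofReal_le_ofReal (Real.exp_le_exp.2 (by linarith)))
    _ = _ := by rw [key]; congr 2; ring

/-- The hypothesis makes c t the regression coefficient of the increment on W s; residual and W s
are then uncorrelated and jointly Gaussian. Stating it as a product rather than a quotient leaves
room for v s = 0. -/
lemma indepFun_residual (h : IsStatIncrGaussian W v P) (s : ℝ) (c : ℝ → ℝ)
    (hc : ∀ t, c t * v s = (v (t + s) - v t - v s) / 2) :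
    IndepFun (W s) (fun ω t => W (t + s) ω - W s ω - c t * W s ω) P := by
  have := h.gaussian.isProbabilityMeasure
  have hG : IsGaussianProcess (Sum.elim (fun _ : Unit => W s)
      (fun t ω => W (t + s) ω - W s ω - c t * W s ω)) P := by
    refine IsGaussianProcess.of_isGaussianProcess h.gaussian fun i =>
      ⟨{(i.elim (fun _ => s) (· + s)), s}, ?_⟩
    rcases i with _ | t
    · exact ⟨.proj ⟨s, by simp⟩, fun ω => rfl⟩
    · refine ⟨.proj ⟨t + s, by simp⟩ - .proj ⟨s, by simp⟩ - c t • .proj ⟨s, by simp⟩,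
        fun ω => ?_⟩
      rfl
  have hm := h.measurable
  have hI := hG.indepFun_of_covariance_eq_zero (fun _ => (hm s).aemeasurable)
    (fun t => by have := hm (t + s); have := hm s; fun_prop) (fun _ t => ?_)
  · exact hI.comp (φ := fun f : Unit → ℝ => f ()) (ψ := id) (by fun_prop) measurable_id
  · have h1 := h.memLp_two s
    have h2 := h.memLp_two (t + s)
    rw [covariance_fun_sub_right (Y := fun ω => W (t + s) ω - W s ω) h1 (h2.sub h1)
      (h1.const_mul _), covariance_fun_sub_right h1 h2 h1,
      covariance_const_mul_right, covariance_self h1.aemeasurable, h.variance_eq, covariance_comm,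
      h.covariance_eq, hc]
    simp only [add_sub_cancel_right]
    ring

/-- Change of measure by `exp (W s - v s / 2)`. -/
lemma lintegral_exp_mul_increments (h : IsStatIncrGaussian W v P) (s : ℝ)
    {F : (ℝ → ℝ) → ENNReal} (hF : Measurable F) :
    ∫⁻ ω, ENNReal.ofReal (Real.exp (W s ω - v s / 2)) * F (fun t => W (t + s) ω - W s ω) ∂P
      = ∫⁻ ω, F (fun t => W t ω + (v (t + s) - v t - v s) / 2) ∂P := by
  have := h.gaussian.isProbabilityMeasure
  let κ : ℝ → ℝ := fun t => (v (t + s) - v t - v s) / 2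
  let c : ℝ → ℝ := fun t => κ t / v s
  have hc : ∀ t, c t * v s = κ t := by
    intro t
    rcases eq_or_ne (v s) 0 with h0 | h0
    -- If v s = 0, then W s vanishes almost surely, so v (t + s) = v t and the covariance κ t is
    -- zero. The quotient by zero in c is therefore harmless.
    · have hz : W s =ᵐ[P] fun _ => 0 := by
        have := (evariance_eq_zero_iff (h.measurable s).aemeasurable).1
          (by rw [← ofReal_variance (h.memLp_two s), h.variance_eq, h0, ENNReal.ofReal_zero])
        rwa [h.mean_zero] at this
      have h1 := h.variance_sub s (t + s)
      have h2 : variance (fun ω => W (t + s) ω - W s ω) P = variance (W (t + s)) P := by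
        refine variance_congr ?_
        filter_upwards [hz] with ω hω
        rw [hω, sub_zero]
      rw [h2, h.variance_eq, add_sub_cancel_right] at h1
      simp only [κ, h1, h0]
      ring
    · simp [c, h0]
  have hind := h.indepFun_residual s c hc
  have hm := h.measurable
  have hmR : Measurable fun ω t => W (t + s) ω - W s ω - c t * W s ω :=
    measurable_pi_lambda _ fun t => by have := hm (t + s); have := hm s; fun_prop
  have hprod := (indepFun_iff_map_prod_eq_prod_map_map (hm s).aemeasurable hmR.aemeasurable).1 hind
  have hlaw : P.map (W s) = gaussianReal 0 (v s).toNNReal := by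
    rw [(h.gaussian.hasGaussianLaw_eval s).map_eq_of_integral_eq_zero (h.mean_zero s),
      h.variance_eq]
  have hcoe : ((v s).toNNReal : ℝ) = v s := Real.coe_toNNReal _ (h.nonneg s)
  -- a functional of the pair formed by `W s` and its residual
  have hpair : ∀ G : ℝ × (ℝ → ℝ) → ENNReal, Measurable G →
      ∫⁻ ω, G (W s ω, fun t => W (t + s) ω - W s ω - c t * W s ω) ∂P
        = ∫⁻ r, ∫⁻ z, G (z, r) ∂(gaussianReal 0 (v s).toNNReal)
          ∂(P.map fun ω t => W (t + s) ω - W s ω - c t * W s ω) := by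
    intro G hG
    rw [← lintegral_map (f := G) hG ((hm s).prodMk hmR), hprod, hlaw]
    exact lintegral_prod_symm' _ hG
  have e1 := hpair (fun z => ENNReal.ofReal (Real.exp (z.1 - v s / 2)) *
    F (fun t => z.2 t + c t * z.1)) (by
      refine Measurable.mul (by fun_prop) (hF.comp (measurable_pi_lambda _ fun t => by fun_prop)))
  have e2 := hpair (fun z => F (fun t => z.2 t + c t * z.1 + κ t))
    (hF.comp (measurable_pi_lambda _ fun t => by fun_prop))
  simp only [sub_add_cancel] at e1 e2
  rw [e1]
  -- With the residual r fixed, tilting translates z by v s, which moves the path by c t * v s = κ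
  -- t.
  have e3 : ∀ r : ℝ → ℝ, ∫⁻ z, ENNReal.ofReal (Real.exp (z - v s / 2)) *
      F (fun t => r t + c t * z) ∂(gaussianReal 0 (v s).toNNReal)
      = ∫⁻ z, F (fun t => r t + c t * z + κ t) ∂(gaussianReal 0 (v s).toNNReal) := by
    intro r
    have := lintegral_exp_mul_gaussianReal (v s).toNNReal (g := fun z => F (fun t => r t + c t * z))
      (hF.comp (measurable_pi_lambda _ fun t => by fun_prop))
    rw [hcoe] at this
    rw [this]
    simp only [mul_add, hc, add_assoc]
  simp_rw [e3]
  rw [← e2]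
  have hmF : Measurable fun w : ℝ → ℝ => F (fun t => w t + κ t) :=
    hF.comp (measurable_pi_lambda _ fun t => by fun_prop)
  have e4 := ((h.stationary_increments s).comp hmF).lintegral_eq
  simp only [Function.comp_apply, trajectory] at e4
  rw [e4]
  refine lintegral_congr_ae ?_
  filter_upwards [h.start_zero] with ω hω
  simp only [hω, sub_zero]
  rfl

/-- Expectations of homogeneous functionals of `W - v / 2` are shift invariant. -/
lemma lintegral_homogeneous_shift (h : IsStatIncrGaussian W v P) (s : ℝ)
    {F : (ℝ → ℝ) → ENNReal} (hF : Measurable F)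
    (hom : ∀ (w : ℝ → ℝ) (c : ℝ), F (fun t => w t + c) = ENNReal.ofReal (Real.exp c) * F w) :
    ∫⁻ ω, F (fun t => W (t + s) ω - v (t + s) / 2) ∂P = ∫⁻ ω, F (fun t => W t ω - v t / 2) ∂P := by
  -- The recentring is chosen so that homogeneity absorbs exp(W s - v s / 2) and restores W (t + s)
  -- - v (t + s) / 2, while on the other side the drift reduces it to W t - v t / 2.
  have h1 := h.lintegral_exp_mul_increments s
    (F := fun w => F (fun t => w t - v (t + s) / 2 + v s / 2))
    (hF.comp (measurable_pi_lambda _ fun t => by fun_prop))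
  simp only [← hom] at h1
  convert h1 using 3 with ω ω <;> congr 1 <;> ext t <;> ring

end IsStatIncrGaussian

/-! ### Asymptotic independence extends from a π-system to the generated σ-algebra. -/

section MixingClass

variable {α : Type*} [MeasurableSpace α] {μ : Measure α} [IsProbabilityMeasure μ] {T : ℕ → α → α}

/-- Two Dynkin-class inductions, first in B for A in the π-system, then in A for arbitrary B. For
disjoint unions, limit and sum are exchanged by domination: each term is at most μ(f i), using
invariance of μ when the union is in B. -/
lemma tendsto_measureReal_inter_of_isPiSystem {C : Set (Set α)} (hC : IsPiSystem C)
    (hgen : ‹MeasurableSpace α› = MeasurableSpace.generateFrom C)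
    (hT : ∀ n, MeasurePreserving (T n) μ μ)
    (h : ∀ A ∈ C, ∀ B ∈ C, Tendsto (fun n => μ.real (A ∩ T n ⁻¹' B)) atTop
      (𝓝 (μ.real A * μ.real B))) {A B : Set α} (hA : MeasurableSet A) (hB : MeasurableSet B) :
    Tendsto (fun n => μ.real (A ∩ T n ⁻¹' B)) atTop (𝓝 (μ.real A * μ.real B)) := by
  have hTm := fun n => (hT n).measurable
  have hTr : ∀ n s, MeasurableSet s → μ.real (T n ⁻¹' s) = μ.real s := fun n s hs =>
    (hT n).measureReal_preimage hs.nullMeasurableSet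
  have hCm : ∀ s ∈ C, MeasurableSet s := fun s hs => by
    rw [hgen]; exact MeasurableSpace.measurableSet_generateFrom hs
  have hsum : ∀ f : ℕ → Set α, Pairwise (fun i j => Disjoint (f i) (f j)) →
      (∀ i, MeasurableSet (f i)) → HasSum (fun i => μ.real (f i)) (μ.real (⋃ i, f i)) := by
    intro f hd hm
    have h1 := measure_iUnion (μ := μ) hd hm
    have h2 := ENNReal.hasSum_toReal (h1 ▸ measure_ne_top μ (⋃ i, f i))
    rwa [← ENNReal.tsum_toReal_eq (fun i => measure_ne_top μ _), ← h1] at h2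
  have step : ∀ A ∈ C, ∀ B, MeasurableSet B →
      Tendsto (fun n => μ.real (A ∩ T n ⁻¹' B)) atTop (𝓝 (μ.real A * μ.real B)) := by
    intro A hA B hB
    have hAm := hCm A hA
    induction B, hB using MeasurableSpace.induction_on_inter hgen hC with
    | empty => simp
    | basic t ht => exact h A hA t ht
    | compl t ht ih =>
      have h1 : ∀ n, μ.real (A ∩ T n ⁻¹' tᶜ) = μ.real A - μ.real (A ∩ T n ⁻¹' t) := fun n => by
        have := measureReal_inter_add_sdiff (μ := μ) (s := A) (hTm n ht)
        rw [Set.preimage_compl, ← Set.sdiff_eq]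
        linarith
      simp_rw [h1, probReal_compl_eq_one_sub ht, mul_sub, mul_one]
      exact ih.const_sub _
    | iUnion f hd hm ih =>
      have h1 : ∀ n, μ.real (A ∩ T n ⁻¹' ⋃ i, f i) = ∑' i, μ.real (A ∩ T n ⁻¹' f i) := fun n => by
        rw [Set.preimage_iUnion, Set.inter_iUnion]
        refine (hsum _ (fun i j hij => ?_) fun i => hAm.inter (hTm n (hm i))).tsum_eq.symm
        exact ((hd hij).preimage _).mono Set.inter_subset_right Set.inter_subset_right
      simp_rw [h1, ← (hsum f hd hm).tsum_eq, ← tsum_mul_left]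
      refine tendsto_tsum_of_dominated_convergence (hsum f hd hm).summable ih
        (Eventually.of_forall fun n i => ?_)
      rw [Real.norm_of_nonneg measureReal_nonneg, ← hTr n _ (hm i)]
      exact measureReal_mono Set.inter_subset_right
  induction A, hA using MeasurableSpace.induction_on_inter hgen hC with
  | empty => simp
  | basic t ht => exact step t ht B hB
  | compl t ht ih =>
    have h1 : ∀ n, μ.real (tᶜ ∩ T n ⁻¹' B) = μ.real B - μ.real (t ∩ T n ⁻¹' B) := fun n => by
      have := measureReal_inter_add_sdiff (μ := μ) (s := T n ⁻¹' B) ht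
      rw [hTr n B hB, Set.inter_comm] at this
      rw [Set.inter_comm, ← Set.sdiff_eq]
      linarith
    simp_rw [h1, probReal_compl_eq_one_sub ht, sub_mul, one_mul]
    exact ih.const_sub _
  | iUnion f hd hm ih =>
    have h1 : ∀ n, μ.real ((⋃ i, f i) ∩ T n ⁻¹' B) = ∑' i, μ.real (f i ∩ T n ⁻¹' B) := fun n => by
      rw [Set.iUnion_inter]
      refine (hsum _ (fun i j hij => ?_) fun i => (hm i).inter (hTm n hB)).tsum_eq.symm
      exact (hd hij).mono Set.inter_subset_left Set.inter_subset_left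
    simp_rw [h1, ← (hsum f hd hm).tsum_eq, ← tsum_mul_right]
    refine tendsto_tsum_of_dominated_convergence (hsum f hd hm).summable ih
      (Eventually.of_forall fun n i => ?_)
    rw [Real.norm_of_nonneg measureReal_nonneg]
    exact measureReal_mono Set.inter_subset_left

end MixingClass

/-! ### Lower cylinders in path space and the associated homogeneous functional. -/

section Cylinder

/-- The paths bounded by `a.2` at time `a.1`, for all `a ∈ L`. -/
def lowerCylinder (L : Finset (ℝ × ℝ)) : Set (ℝ → ℝ) := {f | ∀ a ∈ L, f a.1 ≤ a.2}

lemma lowerCylinder_union (L L' : Finset (ℝ × ℝ)) :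
    lowerCylinder (L ∪ L') = lowerCylinder L ∩ lowerCylinder L' := by
  ext f
  simp only [lowerCylinder, Set.mem_ofPred_eq, Set.mem_inter_iff, Finset.mem_union]
  exact ⟨fun h => ⟨fun a ha => h a (Or.inl ha), fun a ha => h a (Or.inr ha)⟩,
    fun h a ha => ha.elim (h.1 a) (h.2 a)⟩

/-- Translation of the time coordinates. -/
def timeShift (s : ℝ) (L : Finset (ℝ × ℝ)) : Finset (ℝ × ℝ) := L.image fun a => (a.1 + s, a.2)

lemma shift_preimage_lowerCylinder (s : ℝ) (L : Finset (ℝ × ℝ)) :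
    shift s ⁻¹' lowerCylinder L = lowerCylinder (timeShift s L) := by
  ext f
  simp only [lowerCylinder, timeShift, shift, Set.mem_preimage, Set.mem_ofPred_eq,
    Finset.forall_mem_image]

lemma measurableSet_lowerCylinder (L : Finset (ℝ × ℝ)) : MeasurableSet (lowerCylinder L) := by
  have : lowerCylinder L = ⋂ a ∈ L, {f | f a.1 ≤ a.2} := by
    ext f; simp [lowerCylinder]
  rw [this]
  exact L.measurableSet_biInter fun a _ => measurableSet_le (by fun_prop) measurable_const

lemma isPiSystem_range_lowerCylinder : IsPiSystem (Set.range lowerCylinder) := by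
  rintro _ ⟨L, rfl⟩ _ ⟨L', rfl⟩ _
  exact ⟨L ∪ L', lowerCylinder_union L L'⟩

lemma generateFrom_range_lowerCylinder :
    (MeasurableSpace.pi : MeasurableSpace (ℝ → ℝ))
      = MeasurableSpace.generateFrom (Set.range lowerCylinder) := by
  refine le_antisymm ?_ (MeasurableSpace.generateFrom_le ?_)
  · refine iSup_le fun t => ?_
    rw [← measurable_iff_comap_le]
    let : MeasurableSpace (ℝ → ℝ) := MeasurableSpace.generateFrom (Set.range lowerCylinder)
    refine measurable_of_Iic (f := fun f : ℝ → ℝ => f t) fun x => ?_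
    refine MeasurableSpace.measurableSet_generateFrom ⟨{(t, x)}, ?_⟩
    ext f
    simp [lowerCylinder]
  · rintro _ ⟨L, rfl⟩
    exact measurableSet_lowerCylinder L

lemma measurable_shift (s : ℝ) : Measurable (shift s) :=
  measurable_pi_lambda _ fun t => measurable_pi_apply (t + s)

/-- The maximum of `exp (w a.1) / a.2` over `a ∈ L`. -/
def expMax (L : Finset (ℝ × ℝ)) (w : ℝ → ℝ) : ENNReal :=
  L.sup fun a => ENNReal.ofReal (Real.exp (w a.1)) / ENNReal.ofReal a.2

lemma measurable_expMax (L : Finset (ℝ × ℝ)) : Measurable (expMax L) := by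
  classical
  induction L using Finset.induction with
  | empty => exact measurable_const (a := (⊥ : ENNReal))
  | insert a L _ ih =>
    have h1 : expMax (insert a L) = fun w =>
        ENNReal.ofReal (Real.exp (w a.1)) / ENNReal.ofReal a.2 ⊔ expMax L w :=
      funext fun w => Finset.sup_insert
    rw [h1]
    exact Measurable.sup (by fun_prop) ih

lemma expMax_union (L L' : Finset (ℝ × ℝ)) (w : ℝ → ℝ) :
    expMax (L ∪ L') w = max (expMax L w) (expMax L' w) := Finset.sup_union

lemma expMax_timeShift (s : ℝ) (L : Finset (ℝ × ℝ)) (w : ℝ → ℝ) :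
    expMax (timeShift s L) w = expMax L fun t => w (t + s) := by
  rw [expMax, timeShift, Finset.sup_image]; rfl

lemma expMax_add_const (L : Finset (ℝ × ℝ)) (w : ℝ → ℝ) (c : ℝ) :
    expMax L (fun t => w t + c) = ENNReal.ofReal (Real.exp c) * expMax L w := by
  rw [expMax, expMax, Finset.apply_sup_eq_sup_comp_of_linearOrder (ENNReal.ofReal (Real.exp c) * ·)
    (fun x y hxy => mul_le_mul_right hxy _) (by simp)]
  refine Finset.sup_congr rfl fun a _ => ?_
  rw [Function.comp_apply, Real.exp_add, ENNReal.ofReal_mul (Real.exp_pos _).le, mul_comm,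
    mul_div_assoc]

lemma mul_expMax_le_one_iff (L : Finset (ℝ × ℝ)) (w : ℝ → ℝ) (u : ℝ) :
    ENNReal.ofReal (Real.exp u) * expMax L w ≤ 1 ↔ ∀ a ∈ L, Real.exp (u + w a.1) ≤ a.2 := by
  rw [mul_comm, ← ENNReal.le_inv_iff_mul_le, expMax, Finset.sup_le_iff]
  refine forall₂_congr fun a _ => ?_
  rw [ENNReal.le_inv_iff_mul_le]
  -- For a nonpositive threshold the quotient in `expMax` is ⊤, so both sides are false. This lets
  -- cylinders carry arbitrary real thresholds.
  rcases le_or_gt a.2 0 with ha | ha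
  · rw [ENNReal.ofReal_of_nonpos ha, ENNReal.div_zero (by simp [Real.exp_pos]),
      ENNReal.top_mul (by simp [Real.exp_pos])]
    simp only [top_le_iff, ENNReal.one_ne_top, false_iff, not_le]
    exact ha.trans_lt (Real.exp_pos _)
  · rw [← ENNReal.ofReal_div_of_pos ha, ← ENNReal.ofReal_mul (by positivity), ENNReal.ofReal_le_one,
      div_mul_eq_mul_div, div_le_one ha, ← Real.exp_add, add_comm]

end Cylinder

/-! ### Finite-dimensional laws, stationarity, ergodicity and failure of mixing. -/

namespace IsBrownResnickOf

variable {Ω : Type*} [MeasurableSpace Ω] {P : Measure Ω}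
  {X : ℝ → Ω → ℝ} {U : ℕ → Ω → ℝ} {W : ℕ → ℝ → Ω → ℝ} {v : ℝ → ℝ}

/-- Finite-dimensional distributions of a Brown–Resnick process. -/
theorem pathLaw_lowerCylinder (h : IsBrownResnickOf X U W v P) (L : Finset (ℝ × ℝ)) :
    pathLaw X P (lowerCylinder L)
      = expNeg (∫⁻ ω, expMax L (fun t => W 0 t ω - v t / 2) ∂P) := by
  have := (h.gaussian 0).gaussian.isProbabilityMeasure
  have hmX : Measurable (trajectory X) := measurable_pi_lambda _ h.measurable
  have hmW := fun i => (h.gaussian i).measurable_trajectory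
  let F : (ℝ → ℝ) → ENNReal := fun w => expMax L fun t => w t - v t / 2
  have hF : Measurable F :=
    (measurable_expMax L).comp (measurable_pi_lambda _ fun t => by fun_prop)
  let M : ℕ → Ω → ENNReal := fun i ω => F (trajectory (W i) ω)
  have hM : ∀ i, Measurable (M i) := fun i => hF.comp (hmW i)
  have key := h.poisson.measure_forall_exp_mul_le_one hM
    (fun i => ((h.copies i 0).comp hF).map_eq) (h.independent.comp _ fun _ => hF)
    (h.independent_points.comp (φ := id) (ψ := fun (w : ℕ → ℝ → ℝ) i => F (w i)) measurable_id
      (measurable_pi_lambda _ fun i => hF.comp (measurable_pi_apply i)))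
  rw [pathLaw, Measure.map_apply hmX (measurableSet_lowerCylinder L)]
  refine Eq.trans (measure_congr ?_) key
  have hall : ∀ᵐ ω ∂P, ∀ a ∈ L, IsGreatest
      (Set.range fun i => Real.exp (U i ω + W i a.1 ω - v a.1 / 2)) (X a.1 ω) :=
    (ae_ball_iff L.countable_toSet).2 fun a _ => h.eq_max a.1
  filter_upwards [hall] with ω hω
  refine propext ?_
  change (∀ a ∈ L, X a.1 ω ≤ a.2) ↔
    ∀ i, ENNReal.ofReal (Real.exp (U i ω)) * expMax L (fun t => W i t ω - v t / 2) ≤ 1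
  simp_rw [mul_expMax_le_one_iff]
  rw [forall_comm]
  refine forall_congr' fun a => ?_
  rw [forall_comm]
  refine forall_congr' fun ha => ?_
  rw [isLUB_le_iff (hω a ha).isLUB]
  simp only [upperBounds, Set.mem_range, forall_exists_index, forall_apply_eq_imp_iff,
    Set.mem_ofPred_eq, add_sub_assoc]

lemma isProbabilityMeasure_pathLaw (h : IsBrownResnickOf X U W v P) :
    IsProbabilityMeasure (pathLaw X P) :=
  have := (h.gaussian 0).gaussian.isProbabilityMeasure
  Measure.isProbabilityMeasure_map (measurable_pi_lambda _ h.measurable).aemeasurable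

lemma lintegral_expMax_timeShift (h : IsBrownResnickOf X U W v P) (s : ℝ) (L : Finset (ℝ × ℝ)) :
    ∫⁻ ω, expMax (timeShift s L) (fun t => W 0 t ω - v t / 2) ∂P
      = ∫⁻ ω, expMax L (fun t => W 0 t ω - v t / 2) ∂P := by
  simp_rw [expMax_timeShift]
  exact (h.gaussian 0).lintegral_homogeneous_shift s (measurable_expMax L) (expMax_add_const L)

theorem isStationary (h : IsBrownResnickOf X U W v P) : IsStationaryProcess X P := by
  intro s
  have := h.isProbabilityMeasure_pathLaw
  have : IsProbabilityMeasure ((pathLaw X P).map (shift s)) :=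
    Measure.isProbabilityMeasure_map (measurable_shift s).aemeasurable
  refine ext_of_generate_finite _ generateFrom_range_lowerCylinder isPiSystem_range_lowerCylinder
    ?_ (by simp)
  rintro _ ⟨L, rfl⟩
  rw [Measure.map_apply (measurable_shift s) (measurableSet_lowerCylinder L),
    shift_preimage_lowerCylinder, h.pathLaw_lowerCylinder, h.pathLaw_lowerCylinder,
    h.lintegral_expMax_timeShift]

lemma measurePreserving_shift (h : IsBrownResnickOf X U W v P) (s : ℝ) :
    MeasurePreserving (shift s) (pathLaw X P) (pathLaw X P) :=
  ⟨measurable_shift s, h.isStationary s⟩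

lemma measurable_expMax_process (h : IsBrownResnickOf X U W v P) (L : Finset (ℝ × ℝ)) :
    Measurable fun ω => expMax L (fun t => W 0 t ω - v t / 2) :=
  (measurable_expMax L).comp (measurable_pi_lambda _ fun t => by
    have := (h.gaussian 0).measurable t
    fun_prop)

lemma lintegral_expMax_ne_top (h : IsBrownResnickOf X U W v P) {L : Finset (ℝ × ℝ)}
    (hL : ∀ a ∈ L, 0 < a.2) : ∫⁻ ω, expMax L (fun t => W 0 t ω - v t / 2) ∂P ≠ ⊤ := by
  have hm := (h.gaussian 0).measurable
  have h1 : ∫⁻ ω, expMax L (fun t => W 0 t ω - v t / 2) ∂P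
      ≤ ∫⁻ ω, ∑ a ∈ L, ENNReal.ofReal (Real.exp (W 0 a.1 ω - v a.1 / 2)) / ENNReal.ofReal a.2 ∂P :=
    lintegral_mono fun ω => Finset.sup_le fun a ha =>
      Finset.single_le_sum (f := fun a : ℝ × ℝ =>
        ENNReal.ofReal (Real.exp (W 0 a.1 ω - v a.1 / 2)) / ENNReal.ofReal a.2)
        (fun _ _ => zero_le) ha
  refine (h1.trans_lt ?_).ne
  rw [lintegral_finsetSum' _ fun a _ => by have := hm a.1; fun_prop]
  refine ENNReal.sum_lt_top.2 fun a ha => ?_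
  simp_rw [fun x => div_eq_mul_inv x (ENNReal.ofReal a.2)]
  rw [lintegral_mul_const' _ _ (ENNReal.inv_ne_top.2 (by simpa using hL a ha)),
    (h.gaussian 0).lintegral_exp, one_mul]
  exact ENNReal.inv_lt_top.2 (by simpa using hL a ha)

/-- A minimum of two maxima is a maximum of pairwise minima, hence at most their sum, and each
pairwise minimum has an exponentially small mean. The sum of the two inverse thresholds bounds
either one of them. -/
lemma lintegral_min_expMax_le (h : IsBrownResnickOf X U W v P) {L L' : Finset (ℝ × ℝ)}
    (hL : ∀ a ∈ L, 0 < a.2) (hL' : ∀ a ∈ L', 0 < a.2) (s : ℝ) :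
    ∫⁻ ω, min (expMax L (fun t => W 0 t ω - v t / 2))
      (expMax (timeShift s L') (fun t => W 0 t ω - v t / 2)) ∂P
      ≤ ∑ p ∈ L ×ˢ L', ((ENNReal.ofReal p.1.2)⁻¹ + (ENNReal.ofReal p.2.2)⁻¹) *
          ENNReal.ofReal (Real.exp (-(v (s + (p.2.1 - p.1.1)) / 8))) := by
  have hm := (h.gaussian 0).measurable
  let C : (ℝ × ℝ) × (ℝ × ℝ) → ENNReal := fun p =>
    (ENNReal.ofReal p.1.2)⁻¹ + (ENNReal.ofReal p.2.2)⁻¹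
  let e : ℝ → Ω → ENNReal := fun t ω => ENNReal.ofReal (Real.exp (W 0 t ω - v t / 2))
  have hC : ∀ p ∈ L ×ˢ L', C p ≠ ⊤ := fun p hp => by
    rw [Finset.mem_product] at hp
    exact ENNReal.add_ne_top.2 ⟨ENNReal.inv_ne_top.2 (by simpa using hL _ hp.1),
      ENNReal.inv_ne_top.2 (by simpa using hL' _ hp.2)⟩
  have hbound : ∀ ω, min (expMax L (fun t => W 0 t ω - v t / 2))
      (expMax (timeShift s L') (fun t => W 0 t ω - v t / 2))
      ≤ ∑ p ∈ L ×ˢ L', C p * min (e (p.2.1 + s) ω) (e p.1.1 ω) := fun ω => by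
    rw [expMax_timeShift, expMax, expMax, Finset.sup_inf_sup]
    refine Finset.sup_le fun p hp => le_trans ?_
      (Finset.single_le_sum (f := fun p => C p * min (e (p.2.1 + s) ω) (e p.1.1 ω))
        (fun _ _ => zero_le) hp)
    simp only [div_eq_mul_inv, C, e]
    rw [mul_min, mul_comm, mul_comm (ENNReal.ofReal (Real.exp (W 0 (p.2.1 + s) ω - _))), inf_comm]
    exact min_le_min (mul_le_mul_left le_add_self _) (mul_le_mul_left le_self_add _)
  refine (lintegral_mono hbound).trans ?_
  rw [lintegral_finsetSum' _ fun p _ => by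
    have := hm (p.2.1 + s); have := hm p.1.1; simp only [e]; fun_prop]
  refine Finset.sum_le_sum fun p hp => ?_
  rw [lintegral_const_mul' _ _ (hC p hp)]
  refine mul_le_mul_right ?_ _
  refine ((h.gaussian 0).lintegral_min_exp_le p.1.1 (p.2.1 + s)).trans_eq ?_
  congr 4
  ring_nf

/-- Integrating max + min = sum shows that the mean of the minimum is exactly the defect from
independence in the exponent. -/
lemma lintegral_expMax_union_add (h : IsBrownResnickOf X U W v P) (s : ℝ)
    (L L' : Finset (ℝ × ℝ)) :
    ∫⁻ ω, expMax (L ∪ timeShift s L') (fun t => W 0 t ω - v t / 2) ∂P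
      + ∫⁻ ω, min (expMax L (fun t => W 0 t ω - v t / 2))
        (expMax (timeShift s L') (fun t => W 0 t ω - v t / 2)) ∂P
      = ∫⁻ ω, expMax L (fun t => W 0 t ω - v t / 2) ∂P
        + ∫⁻ ω, expMax L' (fun t => W 0 t ω - v t / 2) ∂P := by
  rw [← h.lintegral_expMax_timeShift s L', ← lintegral_add_left (h.measurable_expMax_process _),
    ← lintegral_add_left (h.measurable_expMax_process _)]
  refine lintegral_congr fun ω => ?_
  rw [expMax_union, max_add_min]

/-- A Brown–Resnick process is mixing along a sequence of times which makes `v` diverge. -/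
theorem tendsto_measureReal_inter (h : IsBrownResnickOf X U W v P) {τ : ℕ → ℝ}
    (hτ : ∀ c, Tendsto (fun n => v (τ n + c)) atTop atTop) {A B : Set (ℝ → ℝ)}
    (hA : MeasurableSet A) (hB : MeasurableSet B) :
    Tendsto (fun n => (pathLaw X P).real (A ∩ shift (τ n) ⁻¹' B)) atTop
      (𝓝 ((pathLaw X P).real A * (pathLaw X P).real B)) := by
  have := h.isProbabilityMeasure_pathLaw
  refine tendsto_measureReal_inter_of_isPiSystem isPiSystem_range_lowerCylinder
    generateFrom_range_lowerCylinder (fun n => h.measurePreserving_shift (τ n)) ?_ hA hB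
  rintro _ ⟨L, rfl⟩ _ ⟨L', rfl⟩
  -- A cylinder with a nonpositive threshold has exponent ⊤ and is null. Both sides of the limit are
  -- then zero, and the exponents below may be taken finite.
  have hnull : ∀ {L : Finset (ℝ × ℝ)}, ¬ (∀ a ∈ L, 0 < a.2) →
      pathLaw X P (lowerCylinder L) = 0 := by
    intro L hL
    push Not at hL
    obtain ⟨a, ha, ha0⟩ := hL
    have htop : ∀ w, expMax L w = ⊤ := fun w => top_unique <| by
      refine le_trans (le_of_eq ?_) (Finset.le_sup ha)
      rw [ENNReal.ofReal_of_nonpos ha0, ENNReal.div_zero (by simp [Real.exp_pos])]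
    rw [h.pathLaw_lowerCylinder]
    have := (h.gaussian 0).gaussian.isProbabilityMeasure
    simp [htop]
  by_cases hL : ∀ a ∈ L, 0 < a.2
  swap
  · have h0 : (pathLaw X P).real (lowerCylinder L) = 0 := by simp [measureReal_def, hnull hL]
    rw [h0, zero_mul]
    refine tendsto_const_nhds.congr fun n => (le_antisymm ?_ measureReal_nonneg).symm
    exact (measureReal_mono Set.inter_subset_left).trans_eq h0
  by_cases hL' : ∀ a ∈ L', 0 < a.2
  swap
  · have h0 : (pathLaw X P).real (lowerCylinder L') = 0 := by simp [measureReal_def, hnull hL']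
    rw [h0, mul_zero]
    refine tendsto_const_nhds.congr fun n => (le_antisymm ?_ measureReal_nonneg).symm
    refine (measureReal_mono Set.inter_subset_right).trans_eq ?_
    rw [(h.measurePreserving_shift _).measureReal_preimage
      (measurableSet_lowerCylinder L').nullMeasurableSet, h0]
  simp_rw [measureReal_def]
  rw [← ENNReal.toReal_mul]
  refine (ENNReal.tendsto_toReal (by finiteness)).comp ?_
  let V : Finset (ℝ × ℝ) → ENNReal := fun L => ∫⁻ ω, expMax L (fun t => W 0 t ω - v t / 2) ∂P
  let I : ℝ → ENNReal := fun s => ∫⁻ ω, min (expMax L (fun t => W 0 t ω - v t / 2))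
      (expMax (timeShift s L') (fun t => W 0 t ω - v t / 2)) ∂P
  have hV : ∀ s, V (L ∪ timeShift s L') + I s = V L + V L' := fun s =>
    h.lintegral_expMax_union_add s L L'
  have hI : Tendsto (fun n => I (τ n)) atTop (𝓝 0) := by
    refine tendsto_of_tendsto_of_tendsto_of_le_of_le tendsto_const_nhds ?_ (fun _ => zero_le)
      fun n => h.lintegral_min_expMax_le hL hL' (τ n)
    rw [show (0 : ENNReal) = ∑ p ∈ L ×ˢ L', 0 by simp]
    refine tendsto_finsetSum _ fun p hp => ?_
    rw [Finset.mem_product] at hp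
    have h1 : Tendsto (fun n => ENNReal.ofReal (Real.exp (-(v (τ n + (p.2.1 - p.1.1)) / 8)))) atTop
        (𝓝 0) := by
      rw [← ENNReal.ofReal_zero]
      refine (ENNReal.continuous_ofReal.tendsto 0).comp (Real.tendsto_exp_neg_atTop_nhds_zero.comp ?_)
      exact (hτ _).atTop_div_const (by norm_num)
    have := ENNReal.Tendsto.const_mul (a := (ENNReal.ofReal p.1.2)⁻¹ + (ENNReal.ofReal p.2.2)⁻¹) h1
      (Or.inr (ENNReal.add_ne_top.2 ⟨ENNReal.inv_ne_top.2 (by simpa using hL _ hp.1),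
        ENNReal.inv_ne_top.2 (by simpa using hL' _ hp.2)⟩))
    rwa [mul_zero] at this
  have hVV : Tendsto (fun n => V (L ∪ timeShift (τ n) L')) atTop (𝓝 (V L + V L')) := by
    have hfin : V L + V L' ≠ ⊤ :=
      ENNReal.add_ne_top.2 ⟨h.lintegral_expMax_ne_top hL, h.lintegral_expMax_ne_top hL'⟩
    have := ENNReal.Tendsto.sub (tendsto_const_nhds (x := V L + V L') (f := atTop)) hI (Or.inl hfin)
    rw [tsub_zero] at this
    refine this.congr fun n => ?_
    rw [← hV (τ n)]
    refine ENNReal.add_sub_cancel_right (fun hc => hfin ?_)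
    rw [← hV (τ n), hc, add_top]
  rw [h.pathLaw_lowerCylinder, h.pathLaw_lowerCylinder, ← expNeg_add]
  refine ((continuous_expNeg.tendsto _).comp hVV).congr fun n => ?_
  rw [shift_preimage_lowerCylinder, ← lowerCylinder_union, h.pathLaw_lowerCylinder]
  rfl

/-- An almost invariant event satisfies μ(s ∩ shift⁻¹ s) = μ(s) at every time. Mixing along τ gives
the limit μ(s)², so μ(s) is 0 or 1. -/
theorem isErgodic (h : IsBrownResnickOf X U W v P) {τ : ℕ → ℝ}
    (hτ : ∀ c, Tendsto (fun n => v (τ n + c)) atTop atTop) : IsErgodicProcess X P := by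
  have := h.isProbabilityMeasure_pathLaw
  let : VAdd ℝ (ℝ → ℝ) := ⟨shift⟩
  have hinv : VAddInvariantMeasure ℝ (ℝ → ℝ) (pathLaw X P) :=
    ⟨fun c s hs => (h.measurePreserving_shift c).measure_preimage hs.nullMeasurableSet⟩
  refine @ErgodicVAdd.mk ℝ (ℝ → ℝ) _ _ _ hinv fun {s} hs hs' => ?_
  have h1 := h.tendsto_measureReal_inter hτ hs hs
  have h2 : ∀ n, (pathLaw X P).real (s ∩ shift (τ n) ⁻¹' s) = (pathLaw X P).real s := fun n => by
    refine measureReal_congr ?_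
    have := (ae_eq_refl s).inter (hs' (τ n))
    rwa [Set.inter_self] at this
  simp_rw [h2] at h1
  have h3 := tendsto_nhds_unique tendsto_const_nhds h1
  have h4 : (pathLaw X P).real s = 0 ∨ (pathLaw X P).real s = 1 := by
    rcases eq_or_ne ((pathLaw X P).real s) 0 with h0 | h0
    · exact Or.inl h0
    · exact Or.inr (mul_left_cancel₀ h0 (by linarith))
  rw [eventuallyConst_set']
  rcases h4 with h0 | h0
  · exact Or.inl (ae_eq_empty.2 ((measureReal_eq_zero_iff).1 h0))
  · refine Or.inr (ae_eq_univ.2 ((measureReal_eq_zero_iff).1 ?_))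
    rw [probReal_compl_eq_one_sub hs, h0, sub_self]

/-- The test event is {X(0) ≤ 1}. Its joint probability with its translate by t depends on t only
through v t, hence is constant along τ. Mixing would equate it with the product and force a strictly
positive minimum to have mean zero. -/
theorem not_isMixing (h : IsBrownResnickOf X U W v P) {τ : ℕ → ℝ}
    (hτ : Tendsto τ atTop atTop) (hv : ∀ n, v (τ n) = v (τ 0)) : ¬ IsMixingProcess X P := by
  intro hmix
  have hG := h.gaussian 0
  have hm := hG.measurable
  let L : Finset (ℝ × ℝ) := {(0, 1)}
  let V : Finset (ℝ × ℝ) → ENNReal := fun L => ∫⁻ ω, expMax L (fun t => W 0 t ω - v t / 2) ∂P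
  have hexp : ∀ w, expMax L w = ENNReal.ofReal (Real.exp (w 0)) := fun w => by simp [expMax, L]
  have hVL : V L = 1 := by simp only [V, hexp]; exact hG.lintegral_exp 0
  have h1 := (hmix (lowerCylinder L) (lowerCylinder L) (measurableSet_lowerCylinder L)
    (measurableSet_lowerCylinder L)).comp hτ
  have h2 : ∀ t, pathLaw X P (lowerCylinder L ∩ shift t ⁻¹' lowerCylinder L)
      = expNeg (V (L ∪ timeShift t L)) := fun t => by
    rw [shift_preimage_lowerCylinder, ← lowerCylinder_union, h.pathLaw_lowerCylinder]
  have h3 : ∀ t ω, expMax (L ∪ timeShift t L) (fun t => W 0 t ω - v t / 2)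
      = max (ENNReal.ofReal (Real.exp (W 0 0 ω - v 0 / 2)))
        (ENNReal.ofReal (Real.exp (W 0 t ω - v t / 2))) := fun t ω => by
    rw [expMax_union, expMax_timeShift, hexp, hexp, zero_add]
  have h4 : ∀ n, V (L ∪ timeShift (τ n) L) = V (L ∪ timeShift (τ 0) L) := fun n => by
    -- Since W 0 = 0 almost surely, only the one-dimensional law N(0, v (τ k)) of W (τ k) enters.
    have hlaw : ∀ k, V (L ∪ timeShift (τ k) L) = ∫⁻ z, max (ENNReal.ofReal (Real.exp (0 - v 0 / 2)))
        (ENNReal.ofReal (Real.exp (z - v (τ 0) / 2))) ∂(gaussianReal 0 (v (τ 0)).toNNReal) := by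
      intro k
      rw [← hv k, ← hG.variance_eq (τ k),
        ← (hG.gaussian.hasGaussianLaw_eval (τ k)).map_eq_of_integral_eq_zero (hG.mean_zero _),
        lintegral_map (by fun_prop) (hm _)]
      refine lintegral_congr_ae ?_
      filter_upwards [hG.start_zero] with ω hω
      rw [h3, hω, hG.variance_eq]
    rw [hlaw n, hlaw 0]
  have h5 : expNeg (V (L ∪ timeShift (τ 0) L)) = expNeg (V L + V L) := by
    rw [expNeg_add]
    refine tendsto_nhds_unique (tendsto_const_nhds.congr fun n => ?_)
      (h.pathLaw_lowerCylinder L ▸ h1)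
    rw [Function.comp_apply, h2, h4 n]
  have h6 := h.lintegral_expMax_union_add (τ 0) L L
  have h7 := expNeg_injective h5
  simp only [V] at h7 hVL
  rw [h7, hVL] at h6
  -- Equality of the exponents cancels the finite term 1 + 1 in max + min = sum, leaving the mean of
  -- the minimum equal to 0.
  have h8 := (ENNReal.add_right_inj (by simp)).1 (h6.trans (add_zero _).symm)
  rw [lintegral_eq_zero_iff ((h.measurable_expMax_process _).min (h.measurable_expMax_process _))]
    at h8
  have := hG.gaussian.isProbabilityMeasure
  obtain ⟨ω, hω⟩ := h8.exists
  beta_reduce at hω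
  rw [expMax_timeShift, hexp, hexp] at hω
  simp [not_le.2 (Real.exp_pos _)] at hω

end IsBrownResnickOf

/-! ### Random series with i.i.d. standard Gaussian terms. -/

section GaussianSeries

variable {Ω ι : Type*} [MeasurableSpace Ω] {P : Measure Ω} [Countable ι] {ξ : ι → Ω → ℝ}

/-- The random series `∑ c i * ξ i`. -/
def randomSeries (ξ : ι → Ω → ℝ) (c : ι → ℝ) (ω : Ω) : ℝ := ∑' i, c i * ξ i ω

lemma measurable_randomSeries (hm : ∀ i, Measurable (ξ i)) (c : ι → ℝ) :
    Measurable (randomSeries ξ c) :=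
  Measurable.tsum fun i => (hm i).const_mul (c i)

/-- First moments suffice for absolutely summable coefficients: the expected sum of |c i ξ i| is
E|ξ| times the sum of |c i|. Independence plays no role. -/
lemma ae_summable_randomSeries (hm : ∀ i, Measurable (ξ i))
    (hlaw : ∀ i, P.map (ξ i) = gaussianReal 0 1) {c : ι → ℝ} (hc : Summable c) :
    ∀ᵐ ω ∂P, Summable fun i => c i * ξ i ω := by
  have hK : ∫⁻ x : ℝ, ‖x‖ₑ ∂(gaussianReal 0 1) ≠ ⊤ :=
    ((memLp_id_gaussianReal (μ := 0) (v := 1) 1).integrable le_rfl).2.ne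
  have h1 : ∫⁻ ω, ∑' i, ‖c i * ξ i ω‖ₑ ∂P ≠ ⊤ := by
    rw [lintegral_tsum fun i => by have := hm i; fun_prop]
    have h2 : ∀ i, ∫⁻ ω, ‖c i * ξ i ω‖ₑ ∂P = ‖c i‖ₑ * ∫⁻ x : ℝ, ‖x‖ₑ ∂(gaussianReal 0 1) := by
      intro i
      simp_rw [enorm_mul]
      rw [lintegral_const_mul' _ _ (by simp), ← hlaw i, lintegral_map (by fun_prop) (hm i)]
    simp_rw [h2]
    rw [ENNReal.tsum_mul_right]
    exact ENNReal.mul_ne_top (tsum_enorm_ne_top_iff_summable_norm.2 hc.norm) hK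
  filter_upwards [ae_lt_top' (by have := hm; fun_prop) h1] with ω hω
  exact Summable.of_enorm hω.ne

lemma summable_sq_of_summable {ι : Type*} {c : ι → ℝ} (hc : Summable c) :
    Summable fun i => c i ^ 2 := by
  refine (hc.abs.mul_of_nonneg hc.abs (fun _ => abs_nonneg _) fun _ => abs_nonneg _).comp_injective
    (i := fun i => (i, i)) (fun i j h => (Prod.mk.inj h).1) |>.congr fun i => ?_
  simp [sq]

/-- The characteristic functions of the finite partial sums factorise, and they converge by
dominated convergence. -/
lemma map_randomSeries (hm : ∀ i, Measurable (ξ i))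
    (hlaw : ∀ i, P.map (ξ i) = gaussianReal 0 1) (hind : iIndepFun ξ P) {c : ι → ℝ}
    (hc : Summable c) :
    P.map (randomSeries ξ c) = gaussianReal 0 (∑' i, c i ^ 2).toNNReal := by
  have := hind.isProbabilityMeasure
  have hS := measurable_randomSeries hm c
  have := Measure.isProbabilityMeasure_map (μ := P) hS.aemeasurable
  have hc2 := summable_sq_of_summable hc
  have h0 : 0 ≤ ∑' i, c i ^ 2 := tsum_nonneg fun i => sq_nonneg _
  refine Measure.ext_of_charFun (funext fun u => ?_)
  let S : Finset ι → Ω → ℝ := fun F ω => ∑ i ∈ F, c i * ξ i ω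
  have hmS : ∀ F, Measurable (S F) := fun F => Finset.measurable_sum _ fun i _ => (hm i).const_mul _
  have h1 : ∀ F, ∫ ω, Complex.exp (u * S F ω * Complex.I) ∂P
      = Complex.exp (-(u ^ 2 / 2) * (∑ i ∈ F, c i ^ 2 : ℝ)) := by
    intro F
    have e1 := iIndepFun.charFun_map_fun_finsetSum_eq_prod (s := F) (X := fun i ω => c i * ξ i ω)
      (P := P) (fun i _ => ((hm i).const_mul _).aemeasurable)
      ((hind.comp (fun i x => c i * x) fun i => by fun_prop).restrict F)
    have e2 := congrFun e1 u
    rw [charFun_apply_real, integral_map (hmS F).aemeasurable (by fun_prop)] at e2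
    rw [e2, Finset.prod_apply, Complex.ofReal_sum, Finset.mul_sum, Complex.exp_sum]
    refine Finset.prod_congr rfl fun i _ => ?_
    have e3 : P.map (fun ω => c i * ξ i ω) = (gaussianReal 0 1).map (c i * ·) := by
      rw [← hlaw i, Measure.map_map (by fun_prop) (hm i)]; rfl
    rw [e3, charFun_map_mul, charFun_gaussianReal]
    congr 1
    push_cast
    ring
  have h2 : Tendsto (fun F => ∫ ω, Complex.exp (u * S F ω * Complex.I) ∂P) atTop
      (𝓝 (∫ ω, Complex.exp (u * randomSeries ξ c ω * Complex.I) ∂P)) := by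
    refine tendsto_integral_filter_of_dominated_convergence (fun _ => 1)
      (Eventually.of_forall fun F => ?_) (Eventually.of_forall fun F => ae_of_all _ fun ω => ?_)
      (integrable_const _) ?_
    · have := hmS F
      exact Measurable.aestronglyMeasurable (by fun_prop)
    · rw [← Complex.ofReal_mul, Complex.norm_exp_ofReal_mul_I]
    · filter_upwards [ae_summable_randomSeries hm hlaw hc] with ω hω
      have h3 : Tendsto (fun F => S F ω) atTop (𝓝 (randomSeries ξ c ω)) := hω.hasSum
      have h4 : Continuous fun x : ℝ => Complex.exp (u * x * Complex.I) := by fun_prop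
      exact (h4.tendsto _).comp h3
  have h3 : Tendsto (fun F => Complex.exp (-(u ^ 2 / 2) * (∑ i ∈ F, c i ^ 2 : ℝ))) atTop
      (𝓝 (Complex.exp (-(u ^ 2 / 2) * (∑' i, c i ^ 2 : ℝ)))) := by
    have h4 : Continuous fun x : ℝ => Complex.exp (-(u ^ 2 / 2) * x) := by fun_prop
    exact (h4.tendsto _).comp hc2.hasSum
  simp_rw [h1] at h2
  rw [charFun_apply_real, integral_map hS.aemeasurable (by fun_prop), tendsto_nhds_unique h2 h3,
    charFun_gaussianReal, Real.coe_toNNReal _ h0]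
  congr 1
  push_cast
  ring

lemma hasGaussianLaw_randomSeries (hm : ∀ i, Measurable (ξ i))
    (hlaw : ∀ i, P.map (ξ i) = gaussianReal 0 1) (hind : iIndepFun ξ P) {c : ι → ℝ}
    (hc : Summable c) : HasGaussianLaw (randomSeries ξ c) P :=
  ⟨by rw [map_randomSeries hm hlaw hind hc]; infer_instance⟩

lemma integral_randomSeries (hm : ∀ i, Measurable (ξ i))
    (hlaw : ∀ i, P.map (ξ i) = gaussianReal 0 1) (hind : iIndepFun ξ P) {c : ι → ℝ}
    (hc : Summable c) : ∫ ω, randomSeries ξ c ω ∂P = 0 := by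
  have h1 := integral_map (μ := P) (measurable_randomSeries hm c).aemeasurable
    (f := fun x : ℝ => x) (by fun_prop)
  rw [← h1, map_randomSeries hm hlaw hind hc, integral_id_gaussianReal]

lemma variance_randomSeries (hm : ∀ i, Measurable (ξ i))
    (hlaw : ∀ i, P.map (ξ i) = gaussianReal 0 1) (hind : iIndepFun ξ P) {c : ι → ℝ}
    (hc : Summable c) : variance (randomSeries ξ c) P = ∑' i, c i ^ 2 := by
  have h1 := variance_map (μ := P) (X := id) (by fun_prop)
    (measurable_randomSeries hm c).aemeasurable
  rw [map_randomSeries hm hlaw hind hc, variance_id_gaussianReal,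
    Real.coe_toNNReal _ (tsum_nonneg fun i => sq_nonneg _)] at h1
  exact h1.symm

/-- Linearity holds only almost surely, because `tsum` takes the value 0 where a series fails to be
summable. -/
lemma sum_mul_randomSeries_ae_eq (hm : ∀ i, Measurable (ξ i))
    (hlaw : ∀ i, P.map (ξ i) = gaussianReal 0 1) {T : Type*} [Fintype T] (l : T → ℝ)
    {b : T → ι → ℝ} (hb : ∀ t, Summable (b t)) :
    (fun ω => ∑ t, l t * randomSeries ξ (b t) ω)
      =ᵐ[P] randomSeries ξ (fun i => ∑ t, l t * b t i) := by
  filter_upwards [ae_all_iff.2 fun t => ae_summable_randomSeries hm hlaw (hb t)] with ω hω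
  simp only [randomSeries]
  simp_rw [← tsum_mul_left, Finset.sum_mul]
  rw [Summable.tsum_finsetSum fun t _ => by
    simpa [mul_assoc] using (hω t).mul_left (l t)]
  simp_rw [mul_assoc]

lemma sub_randomSeries_ae_eq (hm : ∀ i, Measurable (ξ i))
    (hlaw : ∀ i, P.map (ξ i) = gaussianReal 0 1) {c d : ι → ℝ} (hc : Summable c)
    (hd : Summable d) :
    (fun ω => randomSeries ξ c ω - randomSeries ξ d ω) =ᵐ[P] randomSeries ξ (c - d) := by
  filter_upwards [ae_summable_randomSeries hm hlaw hc, ae_summable_randomSeries hm hlaw hd]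
    with ω h1 h2
  simp only [randomSeries, Pi.sub_apply, sub_mul]
  rw [h1.tsum_sub h2]

lemma map_map_randomSeries (hm : ∀ i, Measurable (ξ i))
    (hlaw : ∀ i, P.map (ξ i) = gaussianReal 0 1) (hind : iIndepFun ξ P) {T : Type*} [Fintype T]
    [DecidableEq T] {b : T → ι → ℝ} (hb : ∀ t, Summable (b t)) (L : (T → ℝ) →L[ℝ] ℝ) :
    (P.map fun ω t => randomSeries ξ (b t) ω).map L
      = gaussianReal 0 (∑' i, (∑ t, L (Pi.single t 1) * b t i) ^ 2).toNNReal := by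
  rw [Measure.map_map (by fun_prop)
    (measurable_pi_lambda _ fun t => measurable_randomSeries hm (b t)),
    ← map_randomSeries hm hlaw hind (summable_sum fun t _ => (hb t).mul_left _)]
  refine Measure.map_congr ((EventuallyEq.of_eq ?_).trans
    (sum_mul_randomSeries_ae_eq hm hlaw _ hb))
  ext ω
  have := LinearMap.pi_apply_eq_sum_univ L.toLinearMap fun t => randomSeries ξ (b t) ω
  simp only [ContinuousLinearMap.coe_coe, smul_eq_mul] at this
  rw [Function.comp_apply, this]
  refine Finset.sum_congr rfl fun t _ => ?_
  rw [mul_comm]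
  congr 2
  ext j
  simp [Pi.single_apply, eq_comm]

lemma isGaussianProcess_randomSeries (hm : ∀ i, Measurable (ξ i))
    (hlaw : ∀ i, P.map (ξ i) = gaussianReal 0 1) (hind : iIndepFun ξ P) {T : Type*}
    {b : T → ι → ℝ} (hb : ∀ t, Summable (b t)) :
    IsGaussianProcess (fun t => randomSeries ξ (b t)) P := by
  classical
  exact ⟨fun I => ⟨isGaussian_of_map_eq_gaussianReal fun L =>
    ⟨_, _, map_map_randomSeries hm hlaw hind (b := fun t : I => b t) (fun t => hb t) L⟩⟩⟩

/-- Path laws are determined by finite-dimensional laws, and these are centred Gaussian, determined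
by the variances of linear functionals. Equality of the quadratic forms in the coefficients is
therefore enough. -/
lemma identDistrib_randomSeries (hm : ∀ i, Measurable (ξ i))
    (hlaw : ∀ i, P.map (ξ i) = gaussianReal 0 1) (hind : iIndepFun ξ P) {T : Type*}
    {b b' : T → ι → ℝ} (hb : ∀ t, Summable (b t)) (hb' : ∀ t, Summable (b' t))
    (h : ∀ (I : Finset T) (l : I → ℝ),
      ∑' i, (∑ t, l t * b t i) ^ 2 = ∑' i, (∑ t, l t * b' t i) ^ 2) :
    IdentDistrib (fun ω t => randomSeries ξ (b t) ω) (fun ω t => randomSeries ξ (b' t) ω) P P := by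
  classical
  have := hind.isProbabilityMeasure
  have hmb := fun b : T → ι → ℝ =>
    measurable_pi_lambda (fun ω t => randomSeries ξ (b t) ω)
      (fun t => measurable_randomSeries hm (b t))
  refine ⟨(hmb b).aemeasurable, (hmb b').aemeasurable, ?_⟩
  rw [map_eq_iff_forall_finset_map_restrict_eq (hmb b).aemeasurable (hmb b').aemeasurable]
  intro I
  have hG := (isGaussianProcess_randomSeries hm hlaw hind hb).hasGaussianLaw I
  have hG' := (isGaussianProcess_randomSeries hm hlaw hind hb').hasGaussianLaw I
  have := hG.isGaussian_map
  have := hG'.isGaussian_map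
  refine Measure.ext_of_charFunDual (funext fun L => ?_)
  rw [charFunDual_eq_charFun_map_one, charFunDual_eq_charFun_map_one]
  congr 1
  refine (map_map_randomSeries hm hlaw hind (b := fun t : I => b t) (fun t => hb t) L).trans
    (Eq.trans ?_ (map_map_randomSeries hm hlaw hind (b := fun t : I => b' t) (fun t => hb' t) L).symm)
  rw [h]

end GaussianSeries

/-! ### The dyadic variance function and a Gaussian process realising it. -/

section Dyadic

lemma dyadicTerm_nonneg (t : ℝ) (k : ℕ) : 0 ≤ dyadicTerm t k :=
  sub_nonneg.2 (Real.cos_le_one _)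

lemma dyadicTerm_le (t : ℝ) (k : ℕ) : dyadicTerm t k ≤ (Real.pi * t) ^ 2 / 2 * (1 / 4) ^ k := by
  have h1 := Real.one_sub_sq_div_two_le_cos (x := 2 * Real.pi * t / 2 ^ (k + 1))
  have h2 : (2 * Real.pi * t / 2 ^ (k + 1)) ^ 2 / 2 = (Real.pi * t) ^ 2 / 2 * (1 / 4) ^ k := by
    rw [pow_succ 2 k, show (1 / 4 : ℝ) = (1 / 2) ^ 2 by norm_num, ← pow_mul, mul_comm 2 k, pow_mul,
      one_div_pow]
    field_simp
  rw [dyadicTerm, ← h2]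
  linarith

lemma summable_dyadicTerm (t : ℝ) : Summable (dyadicTerm t) :=
  Summable.of_nonneg_of_le (dyadicTerm_nonneg t) (dyadicTerm_le t)
    ((summable_geometric_of_lt_one (by norm_num) (by norm_num)).mul_left _)

lemma dyadicVariance_nonneg (t : ℝ) : 0 ≤ dyadicVariance t := tsum_nonneg (dyadicTerm_nonneg t)

lemma dyadicVariance_le (t : ℝ) : dyadicVariance t ≤ 2 / 3 * (Real.pi * t) ^ 2 := by
  have h := hasSum_geometric_of_lt_one (r := (1 / 4 : ℝ)) (by norm_num) (by norm_num)
  refine (Summable.tsum_le_tsum (dyadicTerm_le t) (summable_dyadicTerm t)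
    (h.summable.mul_left _)).trans_eq ?_
  rw [tsum_mul_left, h.tsum_eq]
  ring

/-- Doubling t moves the frequencies by one index, leaving a single new leading term. -/
lemma dyadicVariance_two_mul (t : ℝ) :
    dyadicVariance (2 * t) = dyadicVariance t + (1 - Real.cos (2 * Real.pi * t)) := by
  rw [dyadicVariance, (summable_dyadicTerm _).tsum_eq_zero_add, dyadicVariance, add_comm]
  congr 1
  · refine tsum_congr fun k => ?_
    rw [dyadicTerm, dyadicTerm, pow_succ _ (k + 1)]
    congr 2
    field_simp
  · rw [dyadicTerm]
    congr 2
    ring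

lemma dyadicVariance_two_pow (n : ℕ) : dyadicVariance (2 ^ n) = dyadicVariance (2 ^ 0) := by
  induction n with
  | zero => rfl
  | succ n ih =>
    rw [pow_succ, mul_comm, dyadicVariance_two_mul, ih,
      show 2 * Real.pi * 2 ^ n = ((2 ^ n : ℕ) : ℝ) * (2 * Real.pi) by push_cast; ring,
      Real.cos_nat_mul_two_pi, sub_self, add_zero]

/-- The value -1/2 is a fixed point of x ↦ 2x² - 1, the action of angle doubling on the cosine. -/
lemma cos_two_pi_mul_two_pow_div_three (n : ℕ) :
    Real.cos (2 * Real.pi * (2 ^ n / 3)) = -(1 / 2) := by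
  induction n with
  | zero =>
    rw [show 2 * Real.pi * (2 ^ 0 / 3) = Real.pi - Real.pi / 3 by ring, Real.cos_pi_sub,
      Real.cos_pi_div_three]
  | succ n ih =>
    rw [show 2 * Real.pi * (2 ^ (n + 1) / 3) = 2 * (2 * Real.pi * (2 ^ n / 3)) by ring,
      Real.cos_two_mul, ih]
    norm_num

lemma le_dyadicVariance_two_pow_div_three (n : ℕ) :
    3 / 2 * (n : ℝ) ≤ dyadicVariance (2 ^ n / 3) := by
  induction n with
  | zero => simpa using dyadicVariance_nonneg _
  | succ n ih =>
    rw [show (2 : ℝ) ^ (n + 1) / 3 = 2 * (2 ^ n / 3) by ring, dyadicVariance_two_mul,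
      cos_two_pi_mul_two_pow_div_three]
    push_cast
    linarith

/-- Since 1 - cos x = |1 - e^{ix}|²/2, this is |a + b|² ≤ 2|a|² + 2|b|². The difference of the two
sides is a multiple of |e^{ix} + e^{iy} - 2|², whose real and imaginary parts are the squares given
to `nlinarith`. -/
lemma dyadicTerm_le_add (t c : ℝ) (k : ℕ) :
    dyadicTerm t k ≤ 2 * dyadicTerm (t + c) k + 2 * dyadicTerm c k := by
  simp only [dyadicTerm]
  set x := 2 * Real.pi * (t + c) / 2 ^ (k + 1)
  set y := 2 * Real.pi * c / 2 ^ (k + 1)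
  have h : 2 * Real.pi * t / 2 ^ (k + 1) = x - y := by simp only [x, y]; ring
  rw [h, Real.cos_sub]
  nlinarith [sq_nonneg (Real.cos x + Real.cos y - 2), sq_nonneg (Real.sin x + Real.sin y),
    Real.sin_sq_add_cos_sq x, Real.sin_sq_add_cos_sq y]

lemma tendsto_dyadicVariance (c : ℝ) :
    Tendsto (fun n : ℕ => dyadicVariance (2 ^ n / 3 + c)) atTop atTop := by
  -- The bound 3n/2 at 2^n/3 is halved by the factor 2 in the translation inequality.
  have h1 : ∀ n : ℕ, 3 / 4 * (n : ℝ) - dyadicVariance c ≤ dyadicVariance (2 ^ n / 3 + c) := by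
    intro n
    have h2 : dyadicVariance (2 ^ n / 3)
        ≤ 2 * dyadicVariance (2 ^ n / 3 + c) + 2 * dyadicVariance c := by
      simp only [dyadicVariance]
      rw [← tsum_mul_left, ← tsum_mul_left, ← Summable.tsum_add
        ((summable_dyadicTerm _).mul_left 2) ((summable_dyadicTerm _).mul_left 2)]
      exact Summable.tsum_le_tsum (dyadicTerm_le_add _ c) (summable_dyadicTerm _)
        (((summable_dyadicTerm _).mul_left 2).add ((summable_dyadicTerm _).mul_left 2))
    have := le_dyadicVariance_two_pow_div_three n
    linarith
  refine tendsto_atTop_mono h1 (tendsto_atTop_add_const_right _ _ ?_)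
  exact tendsto_natCast_atTop_atTop.const_mul_atTop (by norm_num)

/-- Fourier coefficients of a Gaussian process with variance `dyadicVariance`. -/
def dyadicCoeff (t : ℝ) (p : ℕ × Bool) : ℝ :=
  bif p.2 then (Real.cos (2 * Real.pi * t / 2 ^ (p.1 + 1)) - 1) / √2
  else Real.sin (2 * Real.pi * t / 2 ^ (p.1 + 1)) / √2

/-- Subtracting 1 from the cosine makes its coefficients comparable to `dyadicTerm`, while the sine
coefficients decay geometrically because |sin x| ≤ |x|. -/
lemma summable_dyadicCoeff (t : ℝ) : Summable (dyadicCoeff t) := by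
  refine Summable.of_norm ((summable_prod_of_nonneg fun p => norm_nonneg _).2
    ⟨fun k => Summable.of_finite, ?_⟩)
  have h1 : ∀ k : ℕ, ∑' b, ‖dyadicCoeff t (k, b)‖
      ≤ dyadicTerm t k + |Real.pi * t| * (1 / 2) ^ k := by
    intro k
    have h2 : (1 : ℝ) ≤ √2 := Real.one_le_sqrt.2 (by norm_num)
    have h3 : |2 * Real.pi * t / 2 ^ (k + 1)| = |Real.pi * t| * (1 / 2) ^ k := by
      rw [show 2 * Real.pi * t / 2 ^ (k + 1) = (Real.pi * t) * (1 / 2) ^ k by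
        rw [pow_succ, one_div_pow]; field_simp, abs_mul, abs_of_pos (a := (1 / 2 : ℝ) ^ k) (by positivity)]
    rw [tsum_fintype, Fintype.sum_bool]
    simp only [dyadicCoeff, cond_true, cond_false, norm_div, Real.norm_eq_abs,
      abs_of_nonneg (Real.sqrt_nonneg 2)]
    refine add_le_add ((div_le_self (abs_nonneg _) h2).trans_eq ?_)
      ((div_le_self (abs_nonneg _) h2).trans ?_)
    · rw [abs_sub_comm]
      exact abs_of_nonneg (dyadicTerm_nonneg t k)
    · rw [← h3]
      exact Real.abs_sin_le_abs
  refine Summable.of_nonneg_of_le (fun k => tsum_nonneg fun _ => norm_nonneg _) h1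
    ((summable_dyadicTerm t).add ?_)
  exact (summable_geometric_of_lt_one (by norm_num) (by norm_num)).mul_left _

lemma summable_dyadicCoeff_sub (s t : ℝ) : Summable (dyadicCoeff s - dyadicCoeff t) :=
  (summable_dyadicCoeff s).sub (summable_dyadicCoeff t)

lemma tsum_sq_eq_tsum_bool {c : ℕ × Bool → ℝ} (hc : Summable c) :
    ∑' p, c p ^ 2 = ∑' k, (c (k, true) ^ 2 + c (k, false) ^ 2) := by
  rw [(summable_sq_of_summable hc).tsum_prod]
  exact tsum_congr fun k => by rw [tsum_fintype, Fintype.sum_bool]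

/-- Each frequency contributes half the squared distance between two points of the unit circle,
which is one minus the cosine of the angle between them. -/
lemma tsum_dyadicCoeff_sub_sq (s t : ℝ) :
    ∑' p, (dyadicCoeff s - dyadicCoeff t) p ^ 2 = dyadicVariance (s - t) := by
  rw [tsum_sq_eq_tsum_bool (summable_dyadicCoeff_sub s t), dyadicVariance]
  refine tsum_congr fun k => ?_
  simp only [Pi.sub_apply, dyadicCoeff, cond_true, cond_false, dyadicTerm]
  rw [show 2 * Real.pi * (s - t) / 2 ^ (k + 1)
    = 2 * Real.pi * s / 2 ^ (k + 1) - 2 * Real.pi * t / 2 ^ (k + 1) by ring, Real.cos_sub,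
    ← sub_div, ← sub_div, div_pow, div_pow, Real.sq_sqrt (by norm_num)]
  have h1 := Real.sin_sq_add_cos_sq (2 * Real.pi * s / 2 ^ (k + 1))
  have h2 := Real.sin_sq_add_cos_sq (2 * Real.pi * t / 2 ^ (k + 1))
  linear_combination (h1 + h2) / 2

lemma dyadicCoeff_zero : dyadicCoeff 0 = 0 := by
  ext ⟨k, b⟩
  cases b <;> simp [dyadicCoeff]

/-- Time shifts rotate the increments of the Fourier coefficients. -/
lemma tsum_sq_dyadicCoeff_shift {T : Type*} [Fintype T] (l t : T → ℝ) (s : ℝ) :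
    ∑' p, (∑ j, l j * (dyadicCoeff (t j + s) - dyadicCoeff s) p) ^ 2
      = ∑' p, (∑ j, l j * (dyadicCoeff (t j) - dyadicCoeff 0) p) ^ 2 := by
  have hS : ∀ (f : T → ℝ) (r : ℝ),
      Summable fun p => ∑ j, l j * (dyadicCoeff (f j) - dyadicCoeff r) p := fun f r =>
    summable_sum fun j _ => (summable_dyadicCoeff_sub _ _).mul_left _
  rw [tsum_sq_eq_tsum_bool (hS (fun j => t j + s) s), tsum_sq_eq_tsum_bool (hS t 0)]
  refine tsum_congr fun k => ?_
  let θ : ℝ → ℝ := fun u => 2 * Real.pi * u / 2 ^ (k + 1)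
  have hθ : ∀ u, θ (u + s) = θ u + θ s := fun u => by simp only [θ]; ring
  let A := ∑ j, l j * ((Real.cos (θ (t j)) - 1) / √2)
  let B := ∑ j, l j * (Real.sin (θ (t j)) / √2)
  have h1 : ∑ j, l j * (dyadicCoeff (t j + s) - dyadicCoeff s) (k, true)
      = Real.cos (θ s) * A - Real.sin (θ s) * B := by
    simp only [A, B, Finset.mul_sum, ← Finset.sum_sub_distrib]
    refine Finset.sum_congr rfl fun j _ => ?_
    change l j * ((Real.cos (θ (t j + s)) - 1) / √2 - (Real.cos (θ s) - 1) / √2) = _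
    rw [hθ, Real.cos_add]
    ring
  have h2 : ∑ j, l j * (dyadicCoeff (t j + s) - dyadicCoeff s) (k, false)
      = Real.sin (θ s) * A + Real.cos (θ s) * B := by
    simp only [A, B, Finset.mul_sum, ← Finset.sum_add_distrib]
    refine Finset.sum_congr rfl fun j _ => ?_
    change l j * (Real.sin (θ (t j + s)) / √2 - Real.sin (θ s) / √2) = _
    rw [hθ, Real.sin_add]
    ring
  have h3 : ∑ j, l j * (dyadicCoeff (t j) - dyadicCoeff 0) (k, true) = A := by
    simp only [dyadicCoeff_zero, sub_zero]; rfl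
  have h4 : ∑ j, l j * (dyadicCoeff (t j) - dyadicCoeff 0) (k, false) = B := by
    simp only [dyadicCoeff_zero, sub_zero]; rfl
  rw [h1, h2, h3, h4]
  linear_combination (A ^ 2 + B ^ 2) * Real.sin_sq_add_cos_sq (θ s)

variable {Ω : Type*} [MeasurableSpace Ω] {P : Measure Ω} {ξ : ℕ × Bool → Ω → ℝ}

lemma isStatIncrGaussian_dyadic (hm : ∀ i, Measurable (ξ i))
    (hlaw : ∀ i, P.map (ξ i) = gaussianReal 0 1) (hind : iIndepFun ξ P) :
    IsStatIncrGaussian (fun t => randomSeries ξ (dyadicCoeff t)) dyadicVariance P := by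
  have := hind.isProbabilityMeasure
  have hc := summable_dyadicCoeff
  have hdiff := fun s t => sub_randomSeries_ae_eq hm hlaw (hc s) (hc t)
  have hmW := fun t => measurable_randomSeries hm (dyadicCoeff t)
  have hvar : ∀ s t, variance (fun ω => randomSeries ξ (dyadicCoeff s) ω
      - randomSeries ξ (dyadicCoeff t) ω) P = dyadicVariance (s - t) := fun s t => by
    rw [variance_congr (hdiff s t), variance_randomSeries hm hlaw hind (summable_dyadicCoeff_sub s t),
      tsum_dyadicCoeff_sub_sq]
  have hzero : ∀ ω, randomSeries ξ (dyadicCoeff 0) ω = 0 := fun ω => by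
    simp [randomSeries, dyadicCoeff_zero]
  refine ⟨hmW, isGaussianProcess_randomSeries hm hlaw hind hc,
    fun t => integral_randomSeries hm hlaw hind (hc t), ae_of_all _ hzero, fun t => ?_,
    fun s => ?_, fun t => ?_⟩
  · have := hvar t 0
    simpa [hzero] using this
  · have hm1 : ∀ f : ℝ → ℝ, ∀ r : ℝ, Measurable (trajectory fun t ω =>
        randomSeries ξ (dyadicCoeff (f t)) ω - randomSeries ξ (dyadicCoeff r) ω) := fun f r =>
      measurable_pi_lambda _ fun t => (hmW _).sub (hmW _)
    have hm2 : ∀ f : ℝ → ℝ, ∀ r : ℝ, Measurable (fun ω t =>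
        randomSeries ξ (dyadicCoeff (f t) - dyadicCoeff r) ω) := fun f r =>
      measurable_pi_lambda _ fun t => measurable_randomSeries hm _
    -- The two families agree almost surely at each time only, with a null set depending on the
    -- time; equality of their laws on the product σ-algebra needs no more.
    have key : ∀ f : ℝ → ℝ, ∀ r : ℝ, P.map (trajectory fun t ω =>
        randomSeries ξ (dyadicCoeff (f t)) ω - randomSeries ξ (dyadicCoeff r) ω)
        = P.map (fun ω t => randomSeries ξ (dyadicCoeff (f t) - dyadicCoeff r) ω) := fun f r =>
      map_eq_of_forall_ae_eq (hm1 f r).aemeasurable (hm2 f r).aemeasurable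
        fun t => hdiff (f t) r
    refine ⟨(hm1 (fun t => t + s) s).aemeasurable, (hm1 (fun t => t) 0).aemeasurable, ?_⟩
    rw [key (fun t => t + s) s, key (fun t => t) 0]
    exact (identDistrib_randomSeries hm hlaw hind (fun t => summable_dyadicCoeff_sub (t + s) s)
      (fun t => summable_dyadicCoeff_sub t 0)
      fun I l => tsum_sq_dyadicCoeff_shift l (fun j : I => (j : ℝ)) s).map_eq
  · rw [tendstoInMeasure_iff_dist]
    intro ε hε
    have hmean : ∀ s, ∫ ω, (randomSeries ξ (dyadicCoeff s) ω
        - randomSeries ξ (dyadicCoeff t) ω) ∂P = 0 := fun s => by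
      exact (integral_congr_ae (hdiff s t)).trans
        (integral_randomSeries hm hlaw hind (summable_dyadicCoeff_sub s t))
    have hL2 : ∀ s, MemLp (randomSeries ξ (dyadicCoeff s)) 2 P := fun s =>
      (hasGaussianLaw_randomSeries hm hlaw hind (hc s)).memLp_two
    -- Chebyshev's inequality, with the quadratic bound on the variance of the increment.
    have hle : ∀ s, P {ω | ε ≤ dist (randomSeries ξ (dyadicCoeff s) ω)
        (randomSeries ξ (dyadicCoeff t) ω)}
        ≤ ENNReal.ofReal (2 / 3 * (Real.pi * (s - t)) ^ 2 / ε ^ 2) := fun s => by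
      have h1 := meas_ge_le_variance_div_sq ((hL2 s).sub (hL2 t)) hε
      simp only [Pi.sub_apply] at h1
      rw [hmean s] at h1
      simp only [sub_zero, ← Real.dist_eq] at h1
      refine h1.trans (ENNReal.ofReal_le_ofReal ?_)
      gcongr
      exact (hvar s t).le.trans (dyadicVariance_le _)
    refine tendsto_of_tendsto_of_tendsto_of_le_of_le tendsto_const_nhds ?_ (fun _ => zero_le) hle
    have h2 : Continuous fun s : ℝ => ENNReal.ofReal (2 / 3 * (Real.pi * (s - t)) ^ 2 / ε ^ 2) :=
      ENNReal.continuous_ofReal.comp (by fun_prop)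
    simpa using h2.tendsto t

end Dyadic

/-! ### A Poisson(1) number of i.i.d. points. -/

section Batch

variable {E : Type*} [MeasurableSpace E]

/-- The sum of `h` over the first `z.1` terms of the sequence `z.2`. -/
def batchSum {β : Type*} [AddCommMonoid β] (h : E → β) (z : ℕ × (ℕ → E)) : β :=
  ∑ j ∈ Finset.range z.1, h (z.2 j)

/-- The law of a Poisson number with mean `1` together with an i.i.d. sequence of law `ν`. -/
def batchMeasure (ν : Measure E) [IsProbabilityMeasure ν] : Measure (ℕ × (ℕ → E)) :=
  (poissonMeasure 1).prod (Measure.infinitePi fun _ => ν)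

instance (ν : Measure E) [IsProbabilityMeasure ν] : IsProbabilityMeasure (batchMeasure ν) := by
  unfold batchMeasure; infer_instance

lemma measurable_batchSum {β : Type*} [AddCommMonoid β] [MeasurableSpace β] [MeasurableAdd₂ β]
    {h : E → β} (hh : Measurable h) : Measurable (batchSum h) :=
  measurable_from_prod_countable_right fun n => by
    have hm : ∀ j : ℕ, Measurable fun x : ℕ → E => h (x j) := fun j =>
      hh.comp (measurable_pi_apply j)
    exact Finset.measurable_fun_sum (Finset.range n) fun j _ => hm j

lemma integral_exp_sum_infinitePi (ν : Measure E) [IsProbabilityMeasure ν] {h : E → ℝ}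
    (hh : Measurable h) (n : ℕ) :
    ∫ x : ℕ → E, Complex.exp ((∑ j ∈ Finset.range n, h (x j) : ℝ) * Complex.I)
      ∂(Measure.infinitePi fun _ => ν) = (∫ x, Complex.exp (h x * Complex.I) ∂ν) ^ n := by
  have hm : ∀ j : ℕ, Measurable fun x : ℕ → E => h (x j) := fun j =>
    hh.comp (measurable_pi_apply j)
  have hind : iIndepFun (fun (j : ℕ) (x : ℕ → E) => h (x j)) (Measure.infinitePi fun _ => ν) :=
    iIndepFun_infinitePi (X := fun _ => h) fun _ => hh
  have h1 := congrFun ((hind.precomp Subtype.val_injective).charFun_map_fun_finsetSum_eq_prod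
    (s := Finset.range n) fun j _ => (hm j).aemeasurable) 1
  have h2 : ∀ j : ℕ, charFun ((Measure.infinitePi fun _ : ℕ => ν).map fun x => h (x j)) 1
      = ∫ x, Complex.exp (h x * Complex.I) ∂ν := fun j => by
    have : (fun x : ℕ → E => h (x j)) = h ∘ Function.eval j := rfl
    rw [this, ← Measure.map_map hh (measurable_pi_apply j), Measure.infinitePi_map_eval,
      charFun_apply_real, integral_map hh.aemeasurable (by fun_prop)]
    simp
  rw [Finset.prod_apply, Finset.prod_congr rfl fun j _ => h2 j, Finset.prod_const,
    Finset.card_range, charFun_apply_real,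
    integral_map (Finset.measurable_fun_sum _ fun j _ => hm j).aemeasurable (by fun_prop)] at h1
  simpa using h1

/-- Compound Poisson formula: conditioning on the number of points gives the series of e^{-1} φⁿ/n!,
whose sum is e^{φ - 1}. -/
lemma integral_exp_batchSum (ν : Measure E) [IsProbabilityMeasure ν] {h : E → ℝ}
    (hh : Measurable h) :
    ∫ z, Complex.exp (batchSum h z * Complex.I) ∂(batchMeasure ν)
      = Complex.exp (∫ x, (Complex.exp (h x * Complex.I) - 1) ∂ν) := by
  have hm := measurable_batchSum hh
  have hint : Integrable (fun z => Complex.exp (batchSum h z * Complex.I)) (batchMeasure ν) :=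
    Integrable.of_bound (by fun_prop) 1 (ae_of_all _ fun z => by
      rw [Complex.norm_exp_ofReal_mul_I])
  have hint' : Integrable (fun x => Complex.exp (h x * Complex.I)) ν :=
    Integrable.of_bound (by fun_prop) 1 (ae_of_all _ fun z => by
      rw [Complex.norm_exp_ofReal_mul_I])
  rw [integral_sub hint' (integrable_const 1), integral_const]
  unfold batchMeasure at hint ⊢
  rw [integral_prod _ hint]
  simp only [batchSum]
  simp_rw [integral_exp_sum_infinitePi ν hh]
  set φ := ∫ x, Complex.exp (h x * Complex.I) ∂ν
  rw [integral_poissonMeasure]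
  calc ∑' n : ℕ, (Real.exp (-(1 : NNReal)) * (1 : NNReal) ^ n / (n.factorial)) • φ ^ n
      = ∑' n : ℕ, Complex.exp (-1) * (φ ^ n / n.factorial) := by
        refine tsum_congr fun n => ?_
        rw [Complex.real_smul]
        push_cast
        simp only [one_pow, mul_one]
        ring
    _ = Complex.exp (φ - 1) := by
        rw [tsum_mul_left, (NormedSpace.expSeries_div_hasSum_exp φ).tsum_eq,
          ← Complex.exp_eq_exp_ℂ, ← Complex.exp_add]
        ring_nf
    _ = _ := by simp

lemma lintegral_batchSum (ν : Measure E) [IsProbabilityMeasure ν] {h : E → ENNReal}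
    (hh : Measurable h) :
    ∫⁻ z, batchSum h z ∂(batchMeasure ν)
      = (∫⁻ n : ℕ, n ∂(poissonMeasure 1)) * ∫⁻ x, h x ∂ν := by
  unfold batchMeasure
  rw [lintegral_prod _ (measurable_batchSum hh).aemeasurable, ← lintegral_mul_const _ (by fun_prop)]
  refine lintegral_congr fun n => ?_
  simp only [batchSum]
  have hm : ∀ j : ℕ, Measurable fun x : ℕ → E => h (x j) := fun j =>
    hh.comp (measurable_pi_apply j)
  rw [lintegral_finsetSum _ fun j _ => hm j]
  have : ∀ j : ℕ, ∫⁻ x : ℕ → E, h (x j) ∂(Measure.infinitePi fun _ => ν) = ∫⁻ x, h x ∂ν :=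
    fun j => (measurePreserving_eval_infinitePi (fun _ : ℕ => ν) j).lintegral_comp hh
  simp [this]

lemma lintegral_natCast_poissonMeasure_ne_top (r : NNReal) :
    ∫⁻ n : ℕ, (n : ENNReal) ∂(poissonMeasure r) ≠ ⊤ := by
  rw [poissonMeasure, lintegral_sum_measure]
  have h : ∀ n : ℕ, ∫⁻ m : ℕ, (m : ENNReal)
      ∂(ENNReal.ofReal (Real.exp (-r) * r ^ n / n.factorial) • Measure.dirac n)
      ≤ ENNReal.ofReal (Real.exp (-r) * ((2 * r) ^ n / n.factorial)) := fun n => by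
    rw [lintegral_smul_measure, lintegral_dirac, smul_eq_mul, ← ENNReal.ofReal_natCast,
      ← ENNReal.ofReal_mul (by positivity)]
    refine ENNReal.ofReal_le_ofReal ?_
    have : (n : ℝ) ≤ 2 ^ n := by exact_mod_cast (Nat.lt_two_pow_self (n := n)).le
    calc Real.exp (-r) * r ^ n / n.factorial * n ≤ Real.exp (-r) * r ^ n / n.factorial * 2 ^ n := by
          gcongr
      _ = _ := by rw [mul_pow]; ring
  refine ne_top_of_le_ne_top ?_ (ENNReal.tsum_le_tsum h)
  exact ((Real.summable_pow_div_factorial (2 * (r : ℝ))).mul_left _).tsum_ofReal_ne_top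

end Batch

/-! ### Counts of a superposition of independent batches. -/

section Cluster

lemma batchSum_indicator_toReal {E : Type*} (B : Set E) (z : ℕ × (ℕ → E)) :
    (batchSum (B.indicator 1) z : ENNReal).toReal = batchSum (B.indicator 1) z := by
  unfold batchSum
  rw [ENNReal.toReal_sum fun j _ => ?_]
  · refine Finset.sum_congr rfl fun j _ => ?_
    by_cases hj : z.2 j ∈ B <;> simp [hj]
  · by_cases hj : z.2 j ∈ B <;> simp [hj]

/-- At most one indicator is nonzero at x, so e^{i·} - 1 becomes additive; this additivity in the
exponent produces independence of counts. -/
lemma exp_sum_indicator_sub_one {E ι : Type*} [Fintype ι] {B : ι → Set E}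
    (hd : Pairwise fun i j => Disjoint (B i) (B j)) (s : ι → ℝ) (x : E) :
    Complex.exp ((∑ l, s l * (B l).indicator 1 x : ℝ) * Complex.I) - 1
      = ∑ l, (B l).indicator (fun _ => Complex.exp (s l * Complex.I) - 1) x := by
  classical
  by_cases hx : ∃ l, x ∈ B l
  · obtain ⟨l, hl⟩ := hx
    have hne : ∀ k ≠ l, x ∉ B k := fun k hk hxk => Set.disjoint_left.1 (hd hk) hxk hl
    rw [Finset.sum_eq_single l (fun k _ hk => by simp [hne k hk]) (by simp),
      Finset.sum_eq_single l (fun k _ hk => by simp [hne k hk]) (by simp)]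
    simp [hl]
  · push Not at hx
    simp [hx]

variable {Ω E : Type*} [MeasurableSpace Ω] [MeasurableSpace E]

/-- The number of points in `B` of the union of the batches `Z n`, `n ∈ ℕ`. -/
def clusterCount (Z : ℕ → Ω → ℕ × (ℕ → E)) (B : Set E) (ω : Ω) : ENNReal :=
  ∑' n, batchSum (B.indicator 1) (Z n ω)

variable {P : Measure Ω} {Z : ℕ → Ω → ℕ × (ℕ → E)} {ν : ℕ → Measure E}
  [∀ n, IsProbabilityMeasure (ν n)]

lemma measurable_clusterCount (hm : ∀ n, Measurable (Z n)) {B : Set E} (hB : MeasurableSet B) :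
    Measurable (clusterCount Z B) :=
  Measurable.tsum fun n => (measurable_batchSum (measurable_one.indicator hB)).comp (hm n)

lemma lintegral_clusterCount (hm : ∀ n, Measurable (Z n))
    (hlaw : ∀ n, HasLaw (Z n) (batchMeasure (ν n)) P) {B : Set E} (hB : MeasurableSet B) :
    ∫⁻ ω, clusterCount Z B ω ∂P
      = (∫⁻ n : ℕ, n ∂(poissonMeasure 1)) * Measure.sum ν B := by
  have hb := measurable_batchSum (β := ENNReal) (measurable_one.indicator hB)
  have hbZ : ∀ n, AEMeasurable (fun ω => (batchSum (B.indicator 1) (Z n ω) : ENNReal)) P :=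
    fun n => (hb.comp (hm n)).aemeasurable
  unfold clusterCount
  rw [lintegral_tsum hbZ, Measure.sum_apply _ hB,
    ← ENNReal.tsum_mul_left]
  refine tsum_congr fun n => ?_
  have := lintegral_batchSum (ν n) (measurable_one.indicator hB)
  rw [← (hlaw n).map_eq, lintegral_map hb (hm n)] at this
  simpa [lintegral_indicator_one hB] using this

lemma ae_clusterCount_ne_top (hm : ∀ n, Measurable (Z n))
    (hlaw : ∀ n, HasLaw (Z n) (batchMeasure (ν n)) P) {B : Set E} (hB : MeasurableSet B)
    (hfin : Measure.sum ν B ≠ ⊤) : ∀ᵐ ω ∂P, clusterCount Z B ω ≠ ⊤ := by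
  have h := lintegral_clusterCount hm hlaw hB
  filter_upwards [ae_lt_top (measurable_clusterCount hm hB) (h ▸
    ENNReal.mul_ne_top (lintegral_natCast_poissonMeasure_ne_top 1) hfin)] with ω hω using hω.ne

/-- The exponents of independent batches add up to the total intensity, and they split over the
disjoint sets. The product form yields both the Poisson law of each count and their joint
independence. -/
lemma integral_exp_clusterCount (hm : ∀ n, Measurable (Z n))
    (hlaw : ∀ n, HasLaw (Z n) (batchMeasure (ν n)) P) (hind : iIndepFun Z P)
    {ι : Type*} [Fintype ι] {B : ι → Set E} (hB : ∀ l, MeasurableSet (B l))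
    (hfin : ∀ l, Measure.sum ν (B l) ≠ ⊤) (hd : Pairwise fun i j => Disjoint (B i) (B j))
    (s : ι → ℝ) :
    ∫ ω, Complex.exp ((∑ l, s l * (clusterCount Z (B l) ω).toReal : ℝ) * Complex.I) ∂P
      = ∏ l, Complex.exp ((Measure.sum ν (B l)).toReal
          * (Complex.exp (s l * Complex.I) - 1)) := by
  have : IsProbabilityMeasure P := hind.isProbabilityMeasure
  set h : E → ℝ := fun x => ∑ l, s l * (B l).indicator 1 x with hh
  have hmi : ∀ l, Measurable ((B l).indicator (1 : E → ℝ)) := fun l =>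
    measurable_one.indicator (hB l)
  have hmh : Measurable h := Finset.measurable_fun_sum _ fun l _ => (hmi l).const_mul _
  have hmb := measurable_batchSum hmh
  have hmZ : ∀ n, Measurable fun ω => batchSum h (Z n ω) := fun n => hmb.comp (hm n)
  have hpart : ∀ N, ∫ ω, Complex.exp ((∑ n ∈ Finset.range N, batchSum h (Z n ω) : ℝ)
      * Complex.I) ∂P = Complex.exp (∑ l, (∑ n ∈ Finset.range N, (ν n (B l)).toReal : ℝ)
        * (Complex.exp (s l * Complex.I) - 1)) := fun N => by
    have h1 := congrFun (((hind.comp (fun _ => batchSum h) fun _ => hmb).precomp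
      Subtype.val_injective).charFun_map_fun_finsetSum_eq_prod
      (s := Finset.range N) fun n _ => (hmZ n).aemeasurable) 1
    have h2 : ∀ n, charFun (P.map fun ω => batchSum h (Z n ω)) 1
        = Complex.exp (∑ l, ((ν n (B l)).toReal : ℂ) * (Complex.exp (s l * Complex.I) - 1)) :=
      fun n => by
        have h3 : (fun ω => batchSum h (Z n ω)) = batchSum h ∘ Z n := rfl
        rw [h3, ← Measure.map_map hmb (hm n), (hlaw n).map_eq, charFun_apply_real,
          integral_map hmb.aemeasurable (by fun_prop)]
        simp only [Complex.ofReal_one, one_mul]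
        rw [integral_exp_batchSum _ hmh]
        simp only [hh, exp_sum_indicator_sub_one hd]
        rw [integral_finsetSum _ fun l _ => (integrable_const _).indicator (hB l)]
        simp_rw [integral_indicator (hB _), integral_const, Complex.real_smul]
        simp [Measure.real]
    rw [Finset.prod_apply, charFun_apply_real, integral_map (by fun_prop) (by fun_prop)] at h1
    simp only [Complex.ofReal_one, one_mul] at h1
    rw [h1]
    refine (Finset.prod_congr rfl fun n _ => h2 n).trans ?_
    rw [← Complex.exp_sum, Finset.sum_comm]
    push_cast
    simp_rw [Finset.sum_mul]
  have hlim : Tendsto (fun N => ∫ ω, Complex.exp ((∑ n ∈ Finset.range N, batchSum h (Z n ω) : ℝ)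
      * Complex.I) ∂P) atTop (𝓝 (∫ ω, Complex.exp ((∑ l, s l * (clusterCount Z (B l) ω).toReal : ℝ)
        * Complex.I) ∂P)) := by
    refine tendsto_integral_of_dominated_convergence (fun _ => 1) (fun N => ?_)
      (integrable_const _) (fun N => ae_of_all _ fun ω => by
        rw [Complex.norm_exp_ofReal_mul_I]) ?_
    · have : Measurable fun ω => ∑ n ∈ Finset.range N, batchSum h (Z n ω) := by fun_prop
      exact Measurable.aestronglyMeasurable (by fun_prop)
    filter_upwards [ae_all_iff.2 fun l => ae_clusterCount_ne_top hm hlaw (hB l) (hfin l)] with ω hω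
    have h4 : Tendsto (fun N => ∑ l, s l * ∑ n ∈ Finset.range N,
        (batchSum ((B l).indicator 1) (Z n ω) : ENNReal).toReal) atTop
        (𝓝 (∑ l, s l * (clusterCount Z (B l) ω).toReal)) := by
      refine tendsto_finsetSum _ fun l _ => Tendsto.const_mul _ ?_
      have := (ENNReal.hasSum_toReal (hω l)).tendsto_sum_nat
      rwa [← ENNReal.tsum_toReal_eq (fun n => ENNReal.ne_top_of_tsum_ne_top (hω l) n)] at this
    have h5 : ∀ N, ∑ n ∈ Finset.range N, batchSum h (Z n ω) = ∑ l, s l * ∑ n ∈ Finset.range N,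
        (batchSum ((B l).indicator 1) (Z n ω) : ENNReal).toReal := fun N => by
      simp_rw [batchSum_indicator_toReal, Finset.mul_sum]
      rw [Finset.sum_comm]
      refine Finset.sum_congr rfl fun n _ => ?_
      simp only [batchSum, hh, Finset.mul_sum]
      rw [Finset.sum_comm]
    simp_rw [h5]
    exact (Complex.continuous_exp.tendsto _).comp
      (((Complex.continuous_ofReal.tendsto _).comp h4).mul_const _)
  refine tendsto_nhds_unique hlim ?_
  simp_rw [hpart, ← Complex.exp_sum]
  refine (Complex.continuous_exp.tendsto _).comp (tendsto_finsetSum _ fun l _ =>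
    Tendsto.mul_const _ ((Complex.continuous_ofReal.tendsto _).comp ?_))
  have h6 := hfin l
  rw [Measure.sum_apply _ (hB l)] at h6 ⊢
  have := (ENNReal.hasSum_toReal h6).tendsto_sum_nat
  rwa [← ENNReal.tsum_toReal_eq (fun n => ENNReal.ne_top_of_tsum_ne_top h6 n)] at this

lemma hasLaw_clusterCount (hm : ∀ n, Measurable (Z n))
    (hlaw : ∀ n, HasLaw (Z n) (batchMeasure (ν n)) P) (hind : iIndepFun Z P)
    {B : Set E} (hB : MeasurableSet B) (hfin : Measure.sum ν B ≠ ⊤) :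
    HasLaw (clusterCount Z B)
      ((poissonMeasure (Measure.sum ν B).toNNReal).map (fun n : ℕ => (n : ENNReal))) P := by
  have : IsProbabilityMeasure P := hind.isProbabilityMeasure
  have hmc := measurable_clusterCount hm hB
  refine ⟨hmc.aemeasurable, ?_⟩
  -- Characteristic functions require real values. Counts are almost surely finite, so `toReal`
  -- followed by `ofReal` loses nothing.
  have h1 : P.map (fun ω => (clusterCount Z B ω).toReal)
      = (poissonMeasure (Measure.sum ν B).toNNReal).map (fun n : ℕ => (n : ℝ)) := by
    have : IsProbabilityMeasure (P.map (fun ω => (clusterCount Z B ω).toReal)) :=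
      Measure.isProbabilityMeasure_map (by fun_prop)
    have : IsProbabilityMeasure ((poissonMeasure (Measure.sum ν B).toNNReal).map
      (fun n : ℕ => (n : ℝ))) := Measure.isProbabilityMeasure_map (by fun_prop)
    refine Measure.ext_of_charFun (funext fun t => ?_)
    rw [charFun_map_cast_poissonMeasure, charFun_apply_real,
      integral_map (by fun_prop) (by fun_prop)]
    have := integral_exp_clusterCount hm hlaw hind (ι := Unit) (B := fun _ => B) (fun _ => hB)
      (fun _ => hfin) (fun i j hij => (hij rfl).elim) (fun _ => t)
    simpa [ENNReal.toReal] using this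
  have h2 : P.map (clusterCount Z B)
      = (P.map fun ω => (clusterCount Z B ω).toReal).map ENNReal.ofReal := by
    rw [Measure.map_map (by fun_prop) (by fun_prop)]
    refine Measure.map_congr ?_
    filter_upwards [ae_clusterCount_ne_top hm hlaw hB hfin] with ω hω
    simp [hω]
  rw [h2, h1, Measure.map_map (by fun_prop) (by fun_prop)]
  congr 1
  ext n
  simp

lemma iIndepFun_clusterCount (hm : ∀ n, Measurable (Z n))
    (hlaw : ∀ n, HasLaw (Z n) (batchMeasure (ν n)) P) (hind : iIndepFun Z P)
    {ι : Type*} [Fintype ι] {B : ι → Set E} (hB : ∀ l, MeasurableSet (B l))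
    (hfin : ∀ l, Measure.sum ν (B l) ≠ ⊤) (hd : Pairwise fun i j => Disjoint (B i) (B j)) :
    iIndepFun (fun l => clusterCount Z (B l)) P := by
  have : IsProbabilityMeasure P := hind.isProbabilityMeasure
  have hmc := fun l => measurable_clusterCount hm (hB l)
  have h1 : iIndepFun (fun l ω => (clusterCount Z (B l) ω).toReal) P := by
    refine (iIndepFun_iff_charFun_pi fun l => by fun_prop).2 fun t => ?_
    rw [charFun_apply, integral_map (by fun_prop) (by fun_prop)]
    have h2 := integral_exp_clusterCount hm hlaw hind hB hfin hd t
    have h3 : ∀ l, charFun (P.map fun ω => (clusterCount Z (B l) ω).toReal) (t l)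
        = Complex.exp ((Measure.sum ν (B l)).toReal
          * (Complex.exp (t l * Complex.I) - 1)) := fun l => by
      rw [charFun_apply_real, integral_map (by fun_prop) (by fun_prop)]
      have := integral_exp_clusterCount hm hlaw hind (ι := Unit) (B := fun _ => B l)
        (fun _ => hB l) (fun _ => hfin l) (fun i j hij => (hij rfl).elim) (fun _ => t l)
      simpa using this
    simp_rw [h3, ← h2, PiLp.inner_apply, Real.inner_apply]
    simp [mul_comm]
  refine (h1.comp (fun _ => ENNReal.ofReal) fun _ => ENNReal.measurable_ofReal).congr fun l => ?_
  filter_upwards [ae_clusterCount_ne_top hm hlaw (hB l) (hfin l)] with ω hω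
  simp [hω]

end Cluster

/-! ### Measurable enumeration of the superposed points. -/

lemma measurable_natNth {Ω : Type*} [MeasurableSpace Ω] {p : Ω → ℕ → Prop}
    (hp : ∀ m, MeasurableSet {ω | p ω m}) (hinf : ∀ ω, {m | p ω m}.Infinite) (i : ℕ) :
    Measurable fun ω => Nat.nth (p ω) i := by
  classical
  have hcount : ∀ m, Measurable fun ω => Nat.count (p ω) m := fun m => by
    induction m with
    | zero => simp
    | succ m ih =>
      simp_rw [Nat.count_succ]
      exact ih.add (Measurable.ite (hp m) measurable_const measurable_const)
  refine measurable_to_countable' fun m => ?_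
  have : (fun ω => Nat.nth (p ω) i) ⁻¹' {m} =
      {ω | p ω m} ∩ (fun ω => Nat.count (p ω) m) ⁻¹' {i} := by
    ext ω
    simp only [Set.mem_preimage, Set.mem_singleton_iff, Set.mem_inter_iff, Set.mem_ofPred_eq]
    constructor
    · rintro rfl
      exact ⟨Nat.nth_mem_of_infinite (hinf ω) i, Nat.count_nth_of_infinite (hinf ω) i⟩
    · rintro ⟨h1, rfl⟩
      exact Nat.nth_count h1
  rw [this]
  exact (hp m).inter (hcount m (measurableSet_singleton i))

section Enumeration

variable {Ω E : Type*} [MeasurableSpace Ω] [MeasurableSpace E]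

/-- The pair with code `m` is the index of a point of one of the batches `Z n`, `n ∈ ℕ`. -/
def IsClusterIndex (Z : ℕ → Ω → ℕ × (ℕ → E)) (ω : Ω) (m : ℕ) : Prop :=
  (Nat.unpair m).2 < (Z (Nat.unpair m).1 ω).1

/-- The event that infinitely many of the batches `Z n`, `n ∈ ℕ`, are nonempty. -/
def infiniteCluster (Z : ℕ → Ω → ℕ × (ℕ → E)) : Set Ω := {ω | ∃ᶠ n in atTop, 1 ≤ (Z n ω).1}

/-- An enumeration of the points of the batches `Z n`, `n ∈ ℕ`. -/
def clusterPoint (Z : ℕ → Ω → ℕ × (ℕ → E)) (i : ℕ) (ω : Ω) : E :=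
  -- Off `infiniteCluster Z` the implication holds for every code. The index set is thus infinite
  -- for all ω, and `Nat.nth` never takes its default value.
  let m := Nat.nth (fun m => ω ∈ infiniteCluster Z → IsClusterIndex Z ω m) i
  (Z (Nat.unpair m).1 ω).2 (Nat.unpair m).2

lemma infinite_isClusterIndex {Ω E : Type*} {Z : ℕ → Ω → ℕ × (ℕ → E)} (ω : Ω) :
    {m | ω ∈ infiniteCluster Z → IsClusterIndex Z ω m}.Infinite := by
  by_cases hω : ω ∈ infiniteCluster Z
  · have h := Nat.frequently_atTop_iff_infinite.1 hω
    refine ((h.image (f := fun n => Nat.pair n 0) fun a _ b _ hab => ?_).mono ?_)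
    · simpa using congrArg (fun m => (Nat.unpair m).1) hab
    · rintro _ ⟨n, hn, rfl⟩ -
      simpa [IsClusterIndex] using Nat.succ_le_iff.1 hn
  · simpa [hω] using Set.infinite_univ

lemma limsup_batch_nonempty {Ω E : Type*} {Z : ℕ → Ω → ℕ × (ℕ → E)} :
    limsup (fun n => Z n ⁻¹' {z | 1 ≤ z.1}) atTop = infiniteCluster Z := by
  ext ω
  simp [infiniteCluster, mem_limsup_iff_frequently_mem]

lemma pointCount_clusterPoint {Ω E : Type*} [MeasurableSpace E]
    {Z : ℕ → Ω → ℕ × (ℕ → E)} {B : Set E} (hB : MeasurableSet B) {ω : Ω}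
    (hω : ω ∈ infiniteCluster Z) :
    pointCount (clusterPoint Z) B ω = clusterCount Z B ω := by
  classical
  have hinf := infinite_isClusterIndex (Z := Z) ω
  let p := fun m => ω ∈ infiniteCluster Z → IsClusterIndex Z ω m
  have hp : ∀ m, p m ↔ (Nat.unpair m).2 < (Z (Nat.unpair m).1 ω).1 := fun m => by
    simp [p, hω, IsClusterIndex]
  let g : ℕ × ℕ → ENNReal := fun q =>
    if q.2 < (Z q.1 ω).1 then B.indicator 1 ((Z q.1 ω).2 q.2) else 0
  have h1 : ∀ i, B.indicator 1 (clusterPoint Z i ω) = g (Nat.unpair (Nat.nth p i)) := fun i => by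
    exact (if_pos ((hp _).1 (Nat.nth_mem_of_infinite hinf i))).symm
  rw [pointCount_eq_tsum _ hB]
  simp_rw [h1]
  -- The enumeration may be replaced by all codes, since g vanishes at every code that is not an
  -- index.
  rw [(Nat.nth_injective hinf).tsum_eq (f := fun m => g (Nat.unpair m)),
    show ∑' m, g (Nat.unpair m) = ∑' q, g q from Nat.pairEquiv.symm.tsum_eq g, ENNReal.tsum_prod']
  · refine tsum_congr fun n => ?_
    rw [tsum_eq_sum (s := Finset.range (Z n ω).1)]
    · exact Finset.sum_congr rfl fun j hj => by simp [g, Finset.mem_range.1 hj]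
    · exact fun j hj => by simp [g, Finset.mem_range.not.1 hj]
  · rw [Nat.range_nth_of_infinite hinf]
    intro m hm
    refine (hp m).2 ?_
    by_contra hlt
    exact hm (by simp [g, hlt])

variable {Z : ℕ → Ω → ℕ × (ℕ → E)}

lemma measurableSet_infiniteCluster (hm : ∀ n, Measurable (Z n)) :
    MeasurableSet (infiniteCluster Z) := by
  rw [← limsup_batch_nonempty]
  exact MeasurableSet.measurableSet_limsup fun n =>
    hm n (measurableSet_le measurable_const measurable_fst)

lemma measurable_clusterPoint (hm : ∀ n, Measurable (Z n)) (i : ℕ) :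
    Measurable (clusterPoint Z i) := by
  have hp : ∀ m, MeasurableSet {ω | ω ∈ infiniteCluster Z → IsClusterIndex Z ω m} := fun m => by
    refine (measurableSet_infiniteCluster hm).imp (measurableSet_lt ?_ ?_)
    · fun_prop
    · exact (hm _).fst
  have hidx := measurable_natNth hp infinite_isClusterIndex i
  have hf : Measurable fun q : ℕ × Ω => (Z (Nat.unpair q.1).1 q.2).2 (Nat.unpair q.1).2 :=
    measurable_from_prod_countable_right fun m =>
      (measurable_pi_apply (Nat.unpair m).2).comp (hm (Nat.unpair m).1).snd
  exact hf.comp (hidx.prodMk measurable_id)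

variable {P : Measure Ω} {ν : ℕ → Measure E} [∀ n, IsProbabilityMeasure (ν n)]

/-- Second Borel–Cantelli lemma: the batches are independent and each is nonempty with the same
positive probability. -/
lemma ae_mem_infiniteCluster (hm : ∀ n, Measurable (Z n))
    (hlaw : ∀ n, HasLaw (Z n) (batchMeasure (ν n)) P) (hind : iIndepFun Z P) :
    ∀ᵐ ω ∂P, ω ∈ infiniteCluster Z := by
  have : IsProbabilityMeasure P := hind.isProbabilityMeasure
  let A : Set (ℕ × (ℕ → E)) := {z | 1 ≤ z.1}
  have hA : MeasurableSet A := measurableSet_le measurable_const measurable_fst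
  have hs : iIndepSet (fun n => Z n ⁻¹' A) P := by
    refine (iIndepSet_iff_meas_biInter fun n => hm n hA).2 fun s => ?_
    exact hind.measure_inter_preimage_eq_mul s (sets := fun _ => A) fun _ _ => hA
  have hmeas : ∀ n, P (Z n ⁻¹' A) = poissonMeasure 1 {n | 1 ≤ n} := fun n => by
    rw [← Measure.map_apply (hm n) hA, (hlaw n).map_eq, batchMeasure]
    have : A = {n | 1 ≤ n} ×ˢ Set.univ := by ext; simp [A]
    rw [this, Measure.prod_prod]
    simp
  have hpos : poissonMeasure 1 {n | 1 ≤ n} ≠ 0 := by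
    refine (lt_of_lt_of_le ?_ (measure_mono (show {1} ⊆ {n | 1 ≤ n} by simp))).ne'
    rw [poissonMeasure_singleton]
    simp [Real.exp_pos]
  have h1 := measure_limsup_eq_one (fun n => hm n hA) hs (by
    simp_rw [hmeas]; exact ENNReal.tsum_const_eq_top_of_ne_zero hpos)
  rw [limsup_batch_nonempty] at h1
  exact (prob_compl_eq_zero_iff (measurableSet_infiniteCluster hm)).2 h1

lemma isPoissonPointProcess_clusterPoint (hm : ∀ n, Measurable (Z n))
    (hlaw : ∀ n, HasLaw (Z n) (batchMeasure (ν n)) P) (hind : iIndepFun Z P) :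
    IsPoissonPointProcess (clusterPoint Z) (Measure.sum ν) P := by
  have h : ∀ B, MeasurableSet B → clusterCount Z B =ᵐ[P] pointCount (clusterPoint Z) B :=
    fun B hB => by
      filter_upwards [ae_mem_infiniteCluster hm hlaw hind] with ω hω
      exact (pointCount_clusterPoint hB hω).symm
  refine ⟨measurable_clusterPoint hm, fun B hB hfin => ?_, fun n B hB hfin hd => ?_⟩
  · exact (hasLaw_clusterCount hm hlaw hind hB hfin).congr (h B hB).symm
  · exact (iIndepFun_clusterCount hm hlaw hind hB hfin hd).congr fun j => h _ (hB j)

end Enumeration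

/-! ### Existence for the exponential intensity. -/

/-- A Poisson point process exists for every countable sum of probability measures. -/
lemma exists_isPoissonPointProcess_sum {E : Type} [MeasurableSpace E] (ν : ℕ → Measure E)
    [∀ n, IsProbabilityMeasure (ν n)] :
    ∃ (Ω : Type) (_ : MeasurableSpace Ω) (P : Measure Ω) (_ : IsProbabilityMeasure P)
      (U : ℕ → Ω → E), IsPoissonPointProcess U (Measure.sum ν) P := by
  obtain ⟨Ω, _, P, Z, hm, hlaw, hind, hP⟩ :=
    exists_hasLaw_indepFun (fun _ : ℕ => ℕ × (ℕ → E)) fun n => batchMeasure (ν n)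
  exact ⟨Ω, _, P, hP, clusterPoint Z, isPoissonPointProcess_clusterPoint hm hlaw hind⟩

/-- The sets {e^{-u} < n} increase to ℝ and have mass n, so their successive differences have mass
exactly 1. -/
lemma exists_expIntensity_eq_sum : ∃ ν : ℕ → Measure ℝ, (∀ n, IsProbabilityMeasure (ν n)) ∧
    expIntensity = Measure.sum ν := by
  let A : ℕ → Set ℝ := fun n => {u | ENNReal.ofReal (Real.exp (-u)) < n}
  have hA : ∀ n, MeasurableSet (A n) := fun n => measurableSet_lt (by fun_prop) measurable_const
  have hmono : Monotone A := fun m n hmn u (hu : _ < (m : ENNReal)) =>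
    hu.trans_le (Nat.cast_le.2 hmn)
  have hU : ⋃ n, A n = Set.univ := by
    refine Set.eq_univ_of_forall fun u => Set.mem_iUnion.2 ?_
    exact ENNReal.exists_nat_gt ENNReal.ofReal_ne_top
  have hA0 : A 0 = ∅ := by ext; simp [A]
  let C : ℕ → Set ℝ := fun n => A (n + 1) \ A n
  have hC : ∀ n, MeasurableSet (C n) := fun n => (hA _).diff (hA n)
  have hd : Pairwise (Function.onFun Disjoint C) := by
    have : ∀ m n, m < n → Disjoint (C m) (C n) := fun m n hmn =>
      Set.disjoint_left.2 fun u hu hu' => hu'.2 (hmono hmn hu.1)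
    intro m n hmn
    rcases lt_or_gt_of_ne hmn with h | h
    · exact this m n h
    · exact (this n m h).symm
  have hCU : ⋃ n, C n = Set.univ := by
    refine Set.eq_univ_of_forall fun u => ?_
    classical
    have hex : ∃ n, u ∈ A n := Set.mem_iUnion.1 (hU ▸ Set.mem_univ u)
    have h0 : Nat.find hex ≠ 0 := fun h => by
      have := Nat.find_spec hex
      rw [h, hA0] at this
      exact this
    obtain ⟨k, hk⟩ := Nat.exists_eq_succ_of_ne_zero h0
    refine Set.mem_iUnion.2 ⟨k, ?_, Nat.find_min hex (by omega)⟩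
    have := Nat.find_spec hex
    rwa [hk] at this
  refine ⟨fun n => expIntensity.restrict (C n), fun n => ⟨?_⟩, ?_⟩
  · rw [Measure.restrict_apply_univ, measure_sdiff (hmono n.le_succ) (hA n).nullMeasurableSet,
      expIntensity_setOf_exp_neg_lt, expIntensity_setOf_exp_neg_lt]
    · push_cast
      exact ENNReal.add_sub_cancel_left (by simp)
    · rw [expIntensity_setOf_exp_neg_lt]; simp
  · rw [← Measure.restrict_iUnion hd hC, hCU, Measure.restrict_univ]

lemma exists_isPoissonPointProcess_expIntensity :
    ∃ (Ω : Type) (_ : MeasurableSpace Ω) (P : Measure Ω) (_ : IsProbabilityMeasure P)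
      (U : ℕ → Ω → ℝ), IsPoissonPointProcess U expIntensity P := by
  obtain ⟨ν, hν, h⟩ := exists_expIntensity_eq_sum
  rw [h]
  exact exists_isPoissonPointProcess_sum ν

/-! ### Poisson mean and the intensity as the sum of the laws of the points. -/

lemma lintegral_natCast_poissonMeasure (r : NNReal) :
    ∫⁻ n : ℕ, (n : ENNReal) ∂(poissonMeasure r) = r := by
  have h : ∀ n : ℕ, ((n + 1 : ℕ) : ENNReal) * poissonMeasure r {n + 1}
      = r * poissonMeasure r {n} := fun n => by
    rw [poissonMeasure_singleton, poissonMeasure_singleton, ← ENNReal.ofReal_natCast,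
      ← ENNReal.ofReal_coe_nnreal, ← ENNReal.ofReal_mul (by positivity),
      ← ENNReal.ofReal_mul (by positivity)]
    congr 1
    rw [Nat.factorial_succ]
    push_cast
    field_simp
    ring
  rw [lintegral_countable', tsum_eq_zero_add' ENNReal.summable]
  simp_rw [h]
  have h1 : ∑' n, poissonMeasure r {n} = 1 := by
    have := lintegral_countable' (μ := poissonMeasure r) fun _ => 1
    simpa using this.symm
  rw [ENNReal.tsum_mul_left, h1]
  simp

section Intensity

variable {Ω E : Type*} [MeasurableSpace Ω] [MeasurableSpace E]
variable {P : Measure Ω} {U : ℕ → Ω → E} {Λ : Measure E}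

/-- Campbell's formula: the laws of the points add up to the intensity measure. -/
theorem IsPoissonPointProcess.sum_map_eq [SigmaFinite Λ] (h : IsPoissonPointProcess U Λ P) :
    Measure.sum (fun i => P.map (U i)) = Λ := by
  have key : ∀ B, MeasurableSet B → Λ B ≠ ⊤ → Measure.sum (fun i => P.map (U i)) B = Λ B := by
    intro B hB hfin
    have h1 : ∫⁻ ω, pointCount U B ω ∂P = Λ B := by
      have h2 := (h.law_count B hB hfin).map_eq
      have h3 : ∫⁻ x, x ∂(P.map (pointCount U B)) = ∫⁻ ω, pointCount U B ω ∂P :=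
        lintegral_map measurable_id (measurable_pointCount h.measurable hB)
      rw [← h3, h2, lintegral_map (f := fun x => x) measurable_id (by fun_prop),
        lintegral_natCast_poissonMeasure, ENNReal.coe_toNNReal hfin]
    rw [← h1, Measure.sum_apply _ hB]
    simp_rw [pointCount_eq_tsum U hB]
    rw [lintegral_tsum fun i =>
      ((measurable_one.indicator hB).comp (h.measurable i)).aemeasurable (f := fun ω =>
        B.indicator 1 (U i ω))]
    refine tsum_congr fun i => ?_
    rw [← lintegral_map (measurable_one.indicator hB) (h.measurable i), lintegral_indicator_one hB]
  refine Measure.ext_of_iUnion_eq_univ (iUnion_spanningSets Λ) fun n => ?_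
  ext B hB
  rw [Measure.restrict_apply hB, Measure.restrict_apply hB]
  refine key _ (hB.inter (measurableSet_spanningSets Λ n)) ?_
  exact ((measure_mono Set.inter_subset_right).trans_lt (measure_spanningSets_lt_top Λ n)).ne

end Intensity

/-! ### The maximum of the marked points is attained. -/

section Attained

variable {Ω : Type*} [MeasurableSpace Ω] {P : Measure Ω} {U Y : ℕ → Ω → ℝ} {ρ : Measure ℝ}

/-- Campbell's formula and Tonelli: for a fixed mark y, the expected number of points above m - y is
e^{y - m}. Only independence of each mark from its own point is needed. -/
lemma IsPoissonPointProcess.tsum_measure_lt_add [IsProbabilityMeasure ρ]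
    (h : IsPoissonPointProcess U expIntensity P)
    (hY : ∀ i, Measurable (Y i)) (hρ : ∀ i, P.map (Y i) = ρ) (hind : ∀ i, IndepFun (U i) (Y i) P)
    (m : ℝ) :
    ∑' i, P {ω | m < U i ω + Y i ω}
      = ENNReal.ofReal (Real.exp (-m)) * ∫⁻ y, ENNReal.ofReal (Real.exp y) ∂ρ := by
  have : IsProbabilityMeasure P := by
    refine ⟨?_⟩
    rw [← measure_univ (μ := ρ), ← hρ 0, Measure.map_apply (hY 0) .univ, Set.preimage_univ]
  let S : Set (ℝ × ℝ) := {q | m < q.1 + q.2}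
  have hS : MeasurableSet S := measurableSet_lt measurable_const (by fun_prop)
  have h1 : ∀ i, P {ω | m < U i ω + Y i ω} = ∫⁻ y, P.map (U i) ((fun x => (x, y)) ⁻¹' S) ∂ρ :=
    fun i => by
      have : IsProbabilityMeasure (P.map (U i)) :=
        Measure.isProbabilityMeasure_map (h.measurable i).aemeasurable
      have h2 := (indepFun_iff_map_prod_eq_prod_map_map (h.measurable i).aemeasurable
        (hY i).aemeasurable).1 (hind i)
      rw [← Measure.prod_apply_symm hS, ← hρ i, ← h2,
        Measure.map_apply ((h.measurable i).prodMk (hY i)) hS]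
      rfl
  have h2 : ∀ y, (fun x => (x, y)) ⁻¹' S
      = {u : ℝ | ENNReal.ofReal (Real.exp (-u)) < ENNReal.ofReal (Real.exp (y - m))} := fun y => by
    ext u
    simp only [S, Set.mem_preimage, Set.mem_ofPred_eq, ENNReal.ofReal_lt_ofReal_iff (Real.exp_pos _),
      Real.exp_lt_exp]
    constructor <;> intro _ <;> linarith
  have h3 : ∀ y, MeasurableSet ((fun x : ℝ => (x, y)) ⁻¹' S) := fun y =>
    (measurable_id.prodMk measurable_const) hS
  simp_rw [h1]
  rw [← lintegral_tsum fun i => ?_]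
  · have h4 : ∀ y, ∑' i, P.map (U i) ((fun x => (x, y)) ⁻¹' S)
        = ENNReal.ofReal (Real.exp (-m)) * ENNReal.ofReal (Real.exp y) := fun y => by
      rw [← Measure.sum_apply _ (h3 y), h.sum_map_eq, h2, expIntensity_setOf_exp_neg_lt,
        ← ENNReal.ofReal_mul (Real.exp_nonneg _), ← Real.exp_add]
      ring_nf
    simp_rw [h4]
    rw [lintegral_const_mul _ (by fun_prop)]
  · have : IsProbabilityMeasure (P.map (U i)) :=
      Measure.isProbabilityMeasure_map (h.measurable i).aemeasurable
    exact (measurable_measure_prodMk_right hS).aemeasurable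

lemma exists_isGreatest_range_of_finite {a : ℕ → ℝ} (ha : ∀ m : ℕ, {i | -(m : ℝ) < a i}.Finite) :
    IsGreatest (Set.range a) (⨆ i, a i) := by
  -- The level -m lies below a 0, so the finite set of indices above it is nonempty and contains a
  -- global maximiser.
  obtain ⟨m, hm⟩ := exists_nat_gt (-(a 0))
  obtain ⟨k, hk, hmax⟩ := Set.exists_max_image _ a (ha m) ⟨0, by
    simp only [Set.mem_ofPred_eq]; linarith⟩
  have hg : IsGreatest (Set.range a) (a k) := by
    refine ⟨⟨k, rfl⟩, ?_⟩
    rintro _ ⟨i, rfl⟩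
    by_cases hi : -(m : ℝ) < a i
    · exact hmax i hi
    · exact (not_lt.1 hi).trans (le_of_lt hk)
  rw [iSup, hg.csSup_eq]
  exact hg

/-- By the first Borel–Cantelli lemma, almost surely only finitely many marked points exceed each
level -m. -/
lemma IsPoissonPointProcess.ae_isGreatest_exp [IsProbabilityMeasure ρ]
    (h : IsPoissonPointProcess U expIntensity P)
    (hY : ∀ i, Measurable (Y i)) (hρ : ∀ i, P.map (Y i) = ρ) (hind : ∀ i, IndepFun (U i) (Y i) P)
    (hfin : ∫⁻ y, ENNReal.ofReal (Real.exp y) ∂ρ ≠ ⊤) :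
    ∀ᵐ ω ∂P, IsGreatest (Set.range fun i => Real.exp (U i ω + Y i ω))
      (Real.exp (⨆ i, (U i ω + Y i ω))) := by
  have h1 : ∀ᵐ ω ∂P, ∀ m : ℕ, {i | -(m : ℝ) < U i ω + Y i ω}.Finite := by
    refine ae_all_iff.2 fun m => ae_finite_setOfPred_mem
      (s := fun i => {ω | -(m : ℝ) < U i ω + Y i ω}) ?_
    rw [h.tsum_measure_lt_add hY hρ hind]
    exact ENNReal.mul_ne_top ENNReal.ofReal_ne_top hfin
  filter_upwards [h1] with ω hω
  have h2 := Real.exp_monotone.map_isGreatest (exists_isGreatest_range_of_finite hω)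
  rwa [← Set.range_comp] at h2

end Attained

/-! ### Pullback of the defining properties along measure-preserving maps. -/

section Transfer

variable {Ω Ω' E : Type*} [MeasurableSpace Ω] [MeasurableSpace Ω'] [MeasurableSpace E]
  {P : Measure Ω} {P' : Measure Ω'} {f : Ω' → Ω}

lemma ProbabilityTheory.iIndepFun.comp_measurePreserving {ι β : Type*} [MeasurableSpace β]
    {X : ι → Ω → β} (hX : iIndepFun X P) (hm : ∀ i, Measurable (X i))
    (hf : MeasurePreserving f P' P) : iIndepFun (fun i ω => X i (f ω)) P' := by
  rw [iIndepFun_iff_measure_inter_preimage_eq_mul] at hX ⊢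
  intro s sets hs
  have hs' : ∀ i ∈ s, MeasurableSet (X i ⁻¹' sets i) := fun i hi => hm i (hs i hi)
  have h1 : ⋂ i ∈ s, (fun ω => X i (f ω)) ⁻¹' sets i = f ⁻¹' ⋂ i ∈ s, X i ⁻¹' sets i := by
    ext; simp
  rw [h1, hf.measure_preimage (s.measurableSet_biInter hs').nullMeasurableSet, hX s hs]
  exact Finset.prod_congr rfl fun i hi => (hf.measure_preimage (hs' i hi).nullMeasurableSet).symm

lemma IsPoissonPointProcess.comp_measurePreserving {U : ℕ → Ω → E} {Λ : Measure E}
    (h : IsPoissonPointProcess U Λ P) (hf : MeasurePreserving f P' P) :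
    IsPoissonPointProcess (fun i ω => U i (f ω)) Λ P' := by
  have hU := h.measurable
  refine ⟨fun i => (hU i).comp hf.measurable, fun B hB hfin => ?_, fun n B hB hfin hd => ?_⟩
  · exact (h.law_count B hB hfin).comp hf.hasLaw
  · exact (h.indep_count n B hB hfin hd).comp_measurePreserving
      (fun j => measurable_pointCount hU (hB j)) hf

lemma IsStatIncrGaussian.comp_measurePreserving {W : ℝ → Ω → ℝ} {v : ℝ → ℝ}
    (h : IsStatIncrGaussian W v P) (hf : MeasurePreserving f P' P) :
    IsStatIncrGaussian (fun t ω => W t (f ω)) v P' := by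
  have hm := h.measurable
  have hmap : ∀ {β : Type} [MeasurableSpace β] {g : Ω → β}, Measurable g →
      P'.map (fun ω => g (f ω)) = P.map g := fun hg => by
    rw [← hf.map_eq, Measure.map_map hg hf.measurable]; rfl
  refine ⟨fun t => (hm t).comp hf.measurable, ⟨fun I => ⟨?_⟩⟩, fun t => ?_, ?_, fun t => ?_,
    fun s => ?_, fun t ε hε => ?_⟩
  · have := (h.gaussian.hasGaussianLaw I).isGaussian_map
    rwa [← hmap (by fun_prop)] at this
  · rw [← h.mean_zero t]
    rw [← hf.map_eq, integral_map hf.measurable.aemeasurable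
      (hm t).aestronglyMeasurable]
  · exact hf.quasiMeasurePreserving.ae h.start_zero
  · rw [← h.variance_eq t, ← hf.variance_fun_comp (hm t).aemeasurable]
  · have h1 := h.stationary_increments s
    have h2 : Measurable (trajectory fun t ω => W (t + s) ω - W s ω) :=
      measurable_pi_lambda _ fun t => (hm _).sub (hm _)
    have h3 : Measurable (trajectory fun t ω => W t ω - W 0 ω) :=
      measurable_pi_lambda _ fun t => (hm _).sub (hm _)
    refine ⟨(h2.comp hf.measurable).aemeasurable, (h3.comp hf.measurable).aemeasurable, ?_⟩
    exact (hmap h2).trans (h1.map_eq.trans (hmap h3).symm)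
  · have h1 := h.stochastically_continuous t ε hε
    refine h1.congr fun s => ?_
    refine (hf.measure_preimage (MeasurableSet.nullMeasurableSet ?_)).symm
    exact measurableSet_le measurable_const ((hm s).edist (hm t))

end Transfer

/-! ### Construction of a Brown–Resnick process on a product space. -/

section Existence

variable {Ω₁ Ω₂ : Type*} [MeasurableSpace Ω₁] [MeasurableSpace Ω₂]

/-- The maximum of the marked points of a Poisson point process, the marks being independent. -/
def brownResnickMax (U : ℕ → Ω₁ → ℝ) (W : ℝ → Ω₂ → ℝ) (v : ℝ → ℝ) (t : ℝ)
    (ω : Ω₁ × (ℕ → Ω₂)) : ℝ :=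
  Real.exp (⨆ i, (U i ω.1 + (W t (ω.2 i) - v t / 2)))

/-- The points live on the first factor and the copies of W on the coordinates of an infinite
product, so all independence is built in. The maximum is attained at each time because exp(W t - v t
/ 2) has mean 1. -/
theorem isBrownResnickOf_brownResnickMax {P₁ : Measure Ω₁} [IsProbabilityMeasure P₁]
    {P₂ : Measure Ω₂} [IsProbabilityMeasure P₂] {U : ℕ → Ω₁ → ℝ} {W : ℝ → Ω₂ → ℝ} {v : ℝ → ℝ}
    (hU : IsPoissonPointProcess U expIntensity P₁) (hW : IsStatIncrGaussian W v P₂) :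
    IsBrownResnickOf (brownResnickMax U W v) (fun i ω => U i ω.1) (fun i t ω => W t (ω.2 i)) v
      (P₁.prod (Measure.infinitePi fun _ => P₂)) := by
  have hfst : MeasurePreserving Prod.fst (P₁.prod (Measure.infinitePi fun _ : ℕ => P₂)) P₁ :=
    measurePreserving_fst
  have hsnd : MeasurePreserving Prod.snd (P₁.prod (Measure.infinitePi fun _ : ℕ => P₂))
      (Measure.infinitePi fun _ : ℕ => P₂) := measurePreserving_snd
  have hev : ∀ i : ℕ, MeasurePreserving (fun ω : Ω₁ × (ℕ → Ω₂) => ω.2 i)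
      (P₁.prod (Measure.infinitePi fun _ : ℕ => P₂)) P₂ := fun i =>
    (measurePreserving_eval_infinitePi (fun _ : ℕ => P₂) i).comp hsnd
  have hWm := hW.measurable
  have hUm := hU.measurable
  have hT := hW.measurable_trajectory
  have hlaw : ∀ i, (P₁.prod (Measure.infinitePi fun _ : ℕ => P₂)).map
      (trajectory fun t ω => W t (ω.2 i)) = P₂.map (trajectory W) := fun i => by
    exact (Measure.map_map hT (hev i).measurable).symm.trans (by rw [(hev i).map_eq])
  have hTm : ∀ i : ℕ, Measurable (trajectory fun t (ω : Ω₁ × (ℕ → Ω₂)) => W t (ω.2 i)) :=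
    fun i => hT.comp (hev i).measurable
  have hind : IndepFun (fun (ω : Ω₁ × (ℕ → Ω₂)) i => U i ω.1)
      (fun ω i => trajectory (fun t (ω : Ω₁ × (ℕ → Ω₂)) => W t (ω.2 i)) ω)
      (P₁.prod (Measure.infinitePi fun _ => P₂)) :=
    indepFun_prod (X := fun ω i => U i ω) (Y := fun (ω : ℕ → Ω₂) i => trajectory W (ω i))
      (measurable_pi_lambda _ hUm)
      (measurable_pi_lambda _ fun i => hT.comp (measurable_pi_apply i))
  refine ⟨hU.comp_measurePreserving hfst, fun i => hW.comp_measurePreserving (hev i),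
    fun i j => ⟨(hTm i).aemeasurable, (hTm j).aemeasurable, (hlaw i).trans (hlaw j).symm⟩,
    ?_, hind, fun t => ?_, fun t => ?_⟩
  · exact (iIndepFun_infinitePi (P := fun _ : ℕ => P₂) (X := fun _ => trajectory W)
      fun _ => hT).comp_measurePreserving (fun i => hT.comp (measurable_pi_apply i)) hsnd
  · refine Real.measurable_exp.comp (Measurable.iSup fun i => ?_)
    exact ((hUm i).comp measurable_fst).add
      (((hWm t).comp (hev i).measurable).sub_const _)
  · let Y : ℕ → Ω₁ × (ℕ → Ω₂) → ℝ := fun i ω => W t (ω.2 i) - v t / 2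
    have hg : Measurable fun ω => W t ω - v t / 2 := (hWm t).sub_const _
    have hρ : IsProbabilityMeasure (P₂.map fun ω => W t ω - v t / 2) :=
      Measure.isProbabilityMeasure_map hg.aemeasurable
    have h := (hU.comp_measurePreserving hfst).ae_isGreatest_exp (Y := Y)
      (ρ := P₂.map fun ω => W t ω - v t / 2) (fun i => hg.comp (hev i).measurable)
      (fun i => (Measure.map_map hg (hev i).measurable).symm.trans (by rw [(hev i).map_eq]))
      (fun i => hind.comp (φ := fun u : ℕ → ℝ => u i)
        (ψ := fun w : ℕ → ℝ → ℝ => w i t - v t / 2) (by fun_prop) (by fun_prop))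
      (by
        rw [lintegral_map (by fun_prop) hg, hW.lintegral_exp]
        exact ENNReal.one_ne_top)
    simpa only [Y, brownResnickMax, add_sub_assoc] using h

end Existence

/-! ### The dyadic example. -/

/-- A Brown–Resnick process with the variance function `dyadicVariance` exists. -/
theorem exists_isBrownResnick_dyadicVariance :
    ∃ (Ω : Type) (_ : MeasurableSpace Ω) (P : Measure Ω) (_ : IsProbabilityMeasure P)
      (X : ℝ → Ω → ℝ), IsBrownResnick X dyadicVariance P := by
  obtain ⟨Ω₁, _, P₁, _, U, hU⟩ := exists_isPoissonPointProcess_expIntensity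
  obtain ⟨Ω₂, _, P₂, ξ, hm, hlaw, hind, _⟩ := exists_iid (ℕ × Bool) (gaussianReal 0 1)
  have hW := isStatIncrGaussian_dyadic hm (fun i => (hlaw i).map_eq) hind
  exact ⟨_, inferInstance, _, inferInstance, _, _, _, isBrownResnickOf_brownResnickMax hU hW⟩

/-- Ergodicity uses the times 2^n/3, along which every translate of the variance diverges; failure
of mixing uses 2^n, along which the variance is constant. -/
theorem IsBrownResnick.isStationary_isErgodic_not_isMixing {Ω : Type*} [MeasurableSpace Ω]
    {P : Measure Ω} {X : ℝ → Ω → ℝ} (h : IsBrownResnick X dyadicVariance P) :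
    IsStationaryProcess X P ∧ IsErgodicProcess X P ∧ ¬ IsMixingProcess X P := by
  obtain ⟨U, W, h⟩ := h
  exact ⟨h.isStationary, h.isErgodic tendsto_dyadicVariance,
    h.not_isMixing (tendsto_pow_atTop_atTop_of_one_lt one_lt_two)
      dyadicVariance_two_pow⟩

end

theorem proposition2 :
    (∀ t : ℝ, Summable (dyadicTerm t)) ∧
    (∃ (Ω : Type) (_ : MeasurableSpace Ω) (P : Measure Ω) (_ : IsProbabilityMeasure P)
      (X : ℝ → Ω → ℝ), IsBrownResnick X dyadicVariance P ∧
        IsStationaryProcess X P ∧ IsErgodicProcess X P ∧ ¬ IsMixingProcess X P) ∧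
    (∀ (Ω : Type*) [MeasurableSpace Ω] (P : Measure Ω) [IsProbabilityMeasure P]
      (X : ℝ → Ω → ℝ), IsBrownResnick X dyadicVariance P →
        IsStationaryProcess X P ∧ IsErgodicProcess X P ∧ ¬ IsMixingProcess X P) := by
  obtain ⟨Ω, _, P, hP, X, hX⟩ := exists_isBrownResnick_dyadicVariance
  exact ⟨summable_dyadicTerm, ⟨Ω, _, P, hP, X, hX, hX.isStationary_isErgodic_not_isMixing⟩,
    fun _ _ _ _ _ h => h.isStationary_isErgodic_not_isMixing⟩
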